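/- Let $d\ge 1$, and let $f:\mathbb{R}^d\to\mathbb{R}$ be $L$-smooth with $L>0$, i.e. $f$ is differentiable and $|\nabla f(x)-\nabla f(y)|\le L|x-y|$ for all $x,y$; assume that $f$ has a minimum, $f^*=\min f$. **The two particle systems.** Fix a number of particles $N$ and parameters $h,\eta,N^*>0$, $R_1\ge 0$, $R_2$ and $M_f$. Let $x^0_1,\dots,x^0_N$ be i.i.d. random vectors in $\mathbb{R}^d$ with an arbitrary common law, and let $\xi^m_i$ ($m\ge 0$, $1\le i\le N$) be i.i.d. $\mathcal N(0,I_d)$ random vectors, independent of the $x^0_i$. The Constrained Ensemble Langevin Monte Carlo (CEnLMC) particles are defined by $$x^{m+1}_i=x^m_i-hF^m_i+\sqrt{2h}\,\xi^m_i ,\qquad w^{m+1}_i=x^m_i-hF^m_i,$$ where $F^0_i=\nabla f(x^0_i)$ and, for $m\ge 1$, with $N^m_i=\#\{j\neq i:\ |w^m_j-w^m_i|\le R_2\}$, $$F^m_i=\begin{cases}\nabla f(x^m_i), & \text{if } \sqrt{2h}\,|\xi^{m-1}_i|>R_1\ \text{ or }\ f(x^m_i)>M_f\ \text{ or }\ N^m_i<N^*,\\[2pt]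 \dfrac1{N^m_i}\displaystyle\sum_{j\ne i}F^m_{ij}, & \text{otherwise,}\end{cases}$$ $$F^m_{ij}=\alpha_d\,\frac{f(x^m_j)-f(x^m_i)}{|x^m_j-x^m_i|^2}\,\frac{x^m_j-x^m_i}{\mathrm p^m_j}\,\mathbf 1_{|x^m_j-x^m_i|\le\eta,\ |w^m_j-w^m_i|\le R_2},\qquad \mathrm p^m_j=\frac{e^{-|\xi^{m-1}_j|^2/2}}{(4\pi h)^{d/2}},$$ with $\alpha_d=d/V$, $V$ being the volume of a ball of radius $\eta$ in $\mathbb{R}^d$ (and $F^m_{ij}=0$ if $x^m_j=x^m_i$). The classical Langevin Monte Carlo (LMC) particles driven by the same noise are $z^0_i=x^0_i$, $z^{m+1}_i=z^m_i-h\nabla f(z^m_i)+\sqrt{2h}\,\xi^m_i$. **Theorem.** Assume $$h\le\min\{1/L,\,1/d\},\qquad \max\{\eta,1\}\le R_2,\qquad M_f>f^* .$$ There is an absolute constant $C>0$ (independent of $d$, $N$, $f$, all parameters, the initial law, $m$ and $i$) such that, for all $m\ge 0$ and $1\le i\le N$, $x^m_i-z^m_i$ is integrable and $$\mathbb E|x^m_i-z^m_i|\le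 C\,e^{Lmh}\left(\sqrt{\frac{R_1^d\,(M_f-f^*)\,d^2}{L\,\eta^d N^*}}\;\exp\!\left(\frac{R_2(R_2+R_1)}{2h}\right)+\eta d\right).$$ If moreover $f$ is $\mu$-strongly convex with $\mu>0$, then with $\kappa=L/\mu$, for all $m\ge 0$ and $1\le i\le N$, $$\mathbb E|x^m_i-z^m_i|\le C\left(\sqrt{\frac{R_1^d\,\kappa\,(M_f-f^*)\,d^2}{\mu\,\eta^d N^*}}\;\exp\!\left(\frac{R_2(R_2+R_1)}{2h}\right)+\kappa\eta d\right).$$ -/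

import Mathlib

open MeasureTheory ProbabilityTheory

noncomputable section

/-- The space `ℝ^d` with its Euclidean norm. -/
abbrev RVec (d : ℕ) : Type := EuclideanSpace ℝ (Fin d)

/-- `f` is `L`-smooth: differentiable with `L`-Lipschitz gradient. -/
def IsLSmooth {d : ℕ} (L : ℝ) (f : RVec d → ℝ) : Prop :=
  Differentiable ℝ f ∧ ∀ x y : RVec d, ‖gradient f x - gradient f y‖ ≤ L * ‖x - y‖

/-- The parameters of the algorithm: time step `h`, neighbourhood radius `η`, constraint thresholds
`R₁`, `R₂`, minimal number of neighbours `Nstar`, and threshold `Mf` for the value of `f`. -/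
structure CEnLMCParams where
  h : ℝ
  η : ℝ
  R₁ : ℝ
  R₂ : ℝ
  Nstar : ℝ
  Mf : ℝ

/-- The normalization constant `α_d = d / V`, with `V` the volume of a ball of radius `η`
in `ℝ^d`. -/
def alphaConst (d : ℕ) (η : ℝ) : ℝ :=
  (d : ℝ) / (volume : Measure (RVec d)).real (Metric.closedBall 0 η)

/-- The value `(4πh)^{-d/2} exp(-|ξ|²/2)` at the point `w + √(2h) ξ` of the density of the Gaussian
distribution `𝒩(w, 2h I_d)`. -/
def stepDensity {d : ℕ} (h : ℝ) (ξ : RVec d) : ℝ :=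
  1 / (4 * Real.pi * h) ^ ((d : ℝ) / 2) * Real.exp (-‖ξ‖ ^ 2 / 2)

/-- The number `N_i` of indices `j ≠ i` with `|w_j - w_i| ≤ R₂`. -/
def neighborCount {d N : ℕ} (R₂ : ℝ) (w : Fin N → RVec d) (i : Fin N) : ℕ :=
  Set.ncard {j : Fin N | j ≠ i ∧ ‖w j - w i‖ ≤ R₂}

open Classical in
/-- The contribution `F_{ij}` of particle `j` to the ensemble approximation of `∇f(x_i)`.
Here `x` are the current positions, `w` the deterministic parts of the last update and `ξ` the noise
used in the last update, so that `x_j = w_j + √(2h) ξ_j`. -/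
def pairForce {d N : ℕ} (f : RVec d → ℝ) (p : CEnLMCParams) (x w ξ : Fin N → RVec d)
    (i j : Fin N) : RVec d :=
  if ‖x j - x i‖ ≤ p.η ∧ ‖w j - w i‖ ≤ p.R₂ then
    (alphaConst d p.η * ((f (x j) - f (x i)) / ‖x j - x i‖ ^ 2) / stepDensity p.h (ξ j)) •
      (x j - x i)
  else 0

open Classical in
/-- The force `F_i`: the true gradient if one of the constraints is violated, and the ensemble
approximation otherwise. -/
def cenlmcForce {d N : ℕ} (f : RVec d → ℝ) (p : CEnLMCParams) (x w ξ : Fin N → RVec d)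
    (i : Fin N) : RVec d :=
  if Real.sqrt (2 * p.h) * ‖ξ i‖ > p.R₁ ∨ f (x i) > p.Mf ∨ p.Nstar > (neighborCount p.R₂ w i : ℝ)
  then gradient f (x i)
  else (1 / (neighborCount p.R₂ w i : ℝ)) • ∑ j ∈ Finset.univ.erase i, pairForce f p x w ξ i j

/-- The positions and forces `(x^m, F^m)` of the constrained ensemble Langevin Monte Carlo
algorithm with initial positions `x0` and noise `ξ m i` in step `m`. At `m = 0` there is no previous
update (formally `w = ∞`, so that no particle has a neighbour), and the true gradient is used. -/
def cenlmcState {d N : ℕ} (f : RVec d → ℝ) (p : CEnLMCParams) (x0 : Fin N → RVec d)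
    (ξ : ℕ → Fin N → RVec d) : ℕ → (Fin N → RVec d) × (Fin N → RVec d)
  | 0 => (x0, fun i => gradient f (x0 i))
  | m + 1 =>
    let s := cenlmcState f p x0 ξ m
    let w : Fin N → RVec d := fun i => s.1 i - p.h • s.2 i
    let x : Fin N → RVec d := fun i => w i + Real.sqrt (2 * p.h) • ξ m i
    (x, fun i => cenlmcForce f p x w (ξ m) i)

/-- The position `x^m_i` of particle `i` after `m` steps of the constrained ensemble algorithm. -/
def cenlmc {d N : ℕ} (f : RVec d → ℝ) (p : CEnLMCParams) (x0 : Fin N → RVec d)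
    (ξ : ℕ → Fin N → RVec d) (m : ℕ) (i : Fin N) : RVec d :=
  (cenlmcState f p x0 ξ m).1 i

/-- The position `z^m_i` of particle `i` after `m` steps of classical Langevin Monte Carlo. -/
def lmc {d N : ℕ} (f : RVec d → ℝ) (h : ℝ) (z0 : Fin N → RVec d)
    (ξ : ℕ → Fin N → RVec d) : ℕ → Fin N → RVec d
  | 0 => z0
  | m + 1 => fun i =>
    lmc f h z0 ξ m i - h • gradient f (lmc f h z0 ξ m i) + Real.sqrt (2 * h) • ξ m i

end

/-! Both systems use the same noise, so with `T x = x - h ∇f(x)` the noise cancels and `x^{m+1} -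
z^{m+1} = (T x^m - T z^m) - h (F^m - ∇f(x^m))`. The map `T` is Lipschitz with constant `1 + Lh`, and
`1 - hμ/2` under strong convexity. Everything thus reduces to a bound on `E|F^m - ∇f(x^m)|` that is
uniform in `m` and `i` (`forceError`), which is fed into a linear recursion
(`lintegral_cenlmc_sub_lmc_le`).

For the force error, condition on the past: `w` is then frozen, the last noises are i.i.d. standard
Gaussians, and the set `S` of neighbours of `i` is deterministic. Where a constraint is violated the
error is zero. Elsewhere `f(x_j) - f(x_i)` is its linear part plus a Taylor remainder.

Dividing by the density turns the Gaussian law of `x_j` into Lebesgue measure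
(`lintegral_importance`, `integral_importance`). Hence the linear part is an exactly unbiased
estimator of `∇f(x_i)`, since the average of `u uᵀ/|u|²` over a centred ball is `I/d`; and the
remainders contribute at most `d L η / 2` in mean.

Given `ξ_i`, the linear parts are independent over `j`, so the mean square of their averaged
deviation is at most a single second moment divided by `|S| ≥ N^*`. That second moment involves the
largest weight `1/p_j`, which `inv_stepDensity_le` compares with `1/p_i`. Integrating `1/p_i` over
the noise of particle `i`, confined to the `R₁`-ball, gives back the Lebesgue volume of that ball,
whence the factor `R₁^d / η^d`. The constraint `f(x_i) ≤ M_f` controls `|∇f(x_i)|²`. -/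

open scoped RealInnerProductSpace ENNReal

noncomputable section

/-! ### Smooth and strongly convex functions, and the gradient step -/

namespace IsLSmooth

variable {d : ℕ} {L : ℝ} {f : RVec d → ℝ}

theorem hasDerivAt_line (hf : IsLSmooth L f) (x v : RVec d) (t : ℝ) :
    HasDerivAt (fun s : ℝ => f (x + s • v)) ⟪gradient f (x + t • v), v⟫ t := by
  have h1 := (hf.1 (x + t • v)).hasGradientAt.hasFDerivAt
  have h2 : HasDerivAt (fun s : ℝ => x + s • v) v t := by
    simpa using ((hasDerivAt_id t).smul_const v).const_add x
  exact (h1.comp_hasDerivAt t h2).congr_deriv (by simp)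

/-- Along the segment, the derivative of the Taylor remainder is at most `L t ‖v‖²`, and the mean
value inequality compares it with `L/2 ‖v‖² t²`. -/
theorem abs_sub_le (hf : IsLSmooth L f) (x y : RVec d) :
    |f y - f x - ⟪gradient f x, y - x⟫| ≤ L / 2 * ‖y - x‖ ^ 2 := by
  set v := y - x with hv
  have hd : ∀ t : ℝ, HasDerivAt (fun t : ℝ => f (x + t • v) - f x - t * ⟪gradient f x, v⟫)
      (⟪gradient f (x + t • v), v⟫ - ⟪gradient f x, v⟫) t := fun t =>
    (((hf.hasDerivAt_line x v t).sub_const (f x)).sub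
      ((hasDerivAt_id t).mul_const ⟪gradient f x, v⟫)).congr_deriv (by rw [one_mul])
  have key := image_norm_le_of_norm_deriv_right_le_deriv_boundary (a := 0) (b := 1)
    (f := fun t : ℝ => f (x + t • v) - f x - t * ⟪gradient f x, v⟫)
    (f' := fun t : ℝ => ⟪gradient f (x + t • v), v⟫ - ⟪gradient f x, v⟫)
    (B := fun t => L / 2 * ‖v‖ ^ 2 * t ^ 2) (B' := fun t => L * t * ‖v‖ ^ 2)
    ?_ ?_ ?_ ?_ ?_ (x := 1) (by simp)
  · simpa [hv] using key
  · exact fun t _ => (hd t).continuousAt.continuousWithinAt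
  · intro t _
    exact (hd t).hasDerivWithinAt
  · simp
  · intro t
    have := ((hasDerivAt_id t).pow 2).const_mul (L / 2 * ‖v‖ ^ 2)
    refine this.congr_deriv ?_
    simp; ring
  · intro t ht
    rw [← inner_sub_left, Real.norm_eq_abs]
    refine (abs_real_inner_le_norm _ _).trans ?_
    have := hf.2 (x + t • v) x
    rw [add_sub_cancel_left, norm_smul, Real.norm_eq_abs, abs_of_nonneg ht.1] at this
    nlinarith [norm_nonneg v, mul_le_mul_of_nonneg_right this (norm_nonneg v)]

theorem le_add (hf : IsLSmooth L f) (x y : RVec d) :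
    f y ≤ f x + ⟪gradient f x, y - x⟫ + L / 2 * ‖y - x‖ ^ 2 := by
  linarith [(abs_le.mp (hf.abs_sub_le x y)).2]

/-- A gradient step of size `1/L` decreases `f` by at least `‖∇f‖²/(2L)` and cannot go below `c`.
This is how the threshold `M_f` bounds the gradient. -/
theorem norm_gradient_sq_le (hf : IsLSmooth L f) (hL : 0 < L) {c : ℝ} (hc : ∀ y, c ≤ f y)
    (x : RVec d) : ‖gradient f x‖ ^ 2 ≤ 2 * L * (f x - c) := by
  have h := hf.le_add x (x - L⁻¹ • gradient f x)
  have h2 := hc (x - L⁻¹ • gradient f x)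
  rw [sub_sub_cancel_left, inner_neg_right, inner_smul_right, real_inner_self_eq_norm_sq, norm_neg,
    norm_smul, mul_pow, Real.norm_eq_abs, sq_abs] at h
  have h3 : L / 2 * (L⁻¹ ^ 2 * ‖gradient f x‖ ^ 2) = L⁻¹ * ‖gradient f x‖ ^ 2 / 2 := by
    field_simp
  have h4 : L⁻¹ * ‖gradient f x‖ ^ 2 ≤ 2 * (f x - c) := by linarith
  rw [inv_mul_le_iff₀ hL] at h4
  linarith

theorem continuous_gradient (hf : IsLSmooth L f) : Continuous (gradient f) := by
  refine (LipschitzWith.of_dist_le_mul (K := L.toNNReal) fun x y => ?_).continuous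
  rw [dist_eq_norm, dist_eq_norm]
  exact (hf.2 x y).trans (mul_le_mul_of_nonneg_right (Real.le_coe_toNNReal L) (norm_nonneg _))

/-- Strong convexity on the segment bounds the difference quotient at `x`; let `t → 0+`. -/
theorem add_le_of_convexOn (hf : IsLSmooth L f) {μ : ℝ} (hc : StrongConvexOn Set.univ μ f)
    (x y : RVec d) : f x + ⟪gradient f x, y - x⟫ + μ / 2 * ‖y - x‖ ^ 2 ≤ f y := by
  set v := y - x with hv
  have hd := (hf.hasDerivAt_line x v 0)
  rw [zero_smul, add_zero] at hd
  have h1 := hd.tendsto_slope_zero_right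
  have h2 : Filter.Tendsto (fun t : ℝ => f y - f x - (1 - t) * (μ / 2 * ‖v‖ ^ 2))
      (nhdsWithin 0 (Set.Ioi 0)) (nhds (f y - f x - (1 - 0) * (μ / 2 * ‖v‖ ^ 2))) := by
    refine Filter.Tendsto.mono_left ?_ nhdsWithin_le_nhds
    exact Continuous.tendsto (by fun_prop) 0
  have h3 := le_of_tendsto_of_tendsto h1 h2 ?_
  · linarith
  filter_upwards [Ioo_mem_nhdsGT (show (0 : ℝ) < 1 by norm_num)] with t ht
  have := hc.2 (Set.mem_univ x) (Set.mem_univ y) (sub_nonneg.2 ht.2.le) ht.1.le (by ring)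
  have e : (1 - t) • x + t • y = x + t • v := by rw [hv]; module
  rw [e, norm_sub_rev x y, ← hv] at this
  simp only [zero_add, zero_smul, add_zero, smul_eq_mul] at this ⊢
  rw [inv_mul_le_iff₀ ht.1]
  linarith

/-- Cocoercivity (Baillon–Haddad). At `y + G/L`, with `G` the difference of gradients, the quadratic
upper bound from `y` lies above the tangent plane at `x`; the two inequalities obtained by
exchanging `x` and `y` are added. -/
theorem norm_gradient_sub_sq_le (hf : IsLSmooth L f) (hL : 0 < L)
    (hc : StrongConvexOn Set.univ 0 f) (x y : RVec d) :
    ‖gradient f x - gradient f y‖ ^ 2 ≤ L * ⟪gradient f x - gradient f y, x - y⟫ := by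
  have key : ∀ x y : RVec d, f x + ⟪gradient f x, y - x⟫ +
      L⁻¹ / 2 * ‖gradient f x - gradient f y‖ ^ 2 ≤ f y := by
    intro x y
    set G := gradient f x - gradient f y with hG
    have h1 := hf.le_add y (y + L⁻¹ • G)
    have h2 := hf.add_le_of_convexOn hc x (y + L⁻¹ • G)
    have e1 : ⟪gradient f x, y + L⁻¹ • G - x⟫ = ⟪gradient f x, y - x⟫ + L⁻¹ * ⟪gradient f x, G⟫ := by
      rw [show y + L⁻¹ • G - x = (y - x) + L⁻¹ • G by abel, inner_add_right, inner_smul_right]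
    rw [add_sub_cancel_left, inner_smul_right, norm_smul, mul_pow, Real.norm_eq_abs, sq_abs] at h1
    rw [e1] at h2
    have e2 : ⟪gradient f x, G⟫ - ⟪gradient f y, G⟫ = ‖G‖ ^ 2 := by
      rw [← inner_sub_left, ← hG, real_inner_self_eq_norm_sq]
    have e3 : L / 2 * (L⁻¹ ^ 2 * ‖G‖ ^ 2) = L⁻¹ / 2 * ‖G‖ ^ 2 := by field_simp
    have e4 : L⁻¹ * ⟪gradient f x, G⟫ = L⁻¹ * ⟪gradient f y, G⟫ + L⁻¹ * ‖G‖ ^ 2 := by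
      rw [← e2]; ring
    linarith
  have h1 := key x y
  have h2 := key y x
  rw [norm_sub_rev (gradient f y)] at h2
  have e : ⟪gradient f x - gradient f y, x - y⟫ =
      -⟪gradient f x, y - x⟫ - ⟪gradient f y, x - y⟫ := by
    rw [inner_sub_left, ← inner_neg_right, neg_sub]
  rw [← inv_mul_le_iff₀ hL, e]
  linarith

theorem strong_monotone (hf : IsLSmooth L f) {μ : ℝ} (hc : StrongConvexOn Set.univ μ f)
    (x y : RVec d) : μ * ‖x - y‖ ^ 2 ≤ ⟪gradient f x - gradient f y, x - y⟫ := by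
  have h1 := hf.add_le_of_convexOn hc x y
  have h2 := hf.add_le_of_convexOn hc y x
  rw [norm_sub_rev y x] at h1
  have e : ⟪gradient f x - gradient f y, x - y⟫ =
      -⟪gradient f x, y - x⟫ - ⟪gradient f y, x - y⟫ := by
    rw [inner_sub_left, ← inner_neg_right, neg_sub]
  linarith

theorem strongConvexity_le (hf : IsLSmooth L f) (hd : 0 < d) {μ : ℝ}
    (hc : StrongConvexOn Set.univ μ f) : μ ≤ L := by
  set e : RVec d := EuclideanSpace.single ⟨0, hd⟩ 1
  have he : ‖e‖ = 1 := by simp [e]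
  have h1 := hf.strong_monotone hc e 0
  have h2 := real_inner_le_norm (gradient f e - gradient f 0) (e - 0)
  have h3 := hf.2 e 0
  simp only [sub_zero, he] at h1 h2 h3
  linarith

theorem norm_gradientStep_sub_le (hf : IsLSmooth L f) {h : ℝ} (hh : 0 ≤ h) (x y : RVec d) :
    ‖(x - h • gradient f x) - (y - h • gradient f y)‖ ≤ (1 + L * h) * ‖x - y‖ := by
  rw [show (x - h • gradient f x) - (y - h • gradient f y) =
    (x - y) - h • (gradient f x - gradient f y) by module]
  refine (norm_sub_le _ _).trans ?_
  rw [norm_smul, Real.norm_eq_abs, abs_of_nonneg hh]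
  linarith [mul_le_mul_of_nonneg_left (hf.2 x y) hh]

/-- Expand the square. By cocoercivity and `hL ≤ 1` the quadratic term absorbs only half of the
cross term, leaving the factor `1 - hμ ≤ (1 - hμ/2)²`. -/
theorem norm_gradientStep_sub_le_of_strongConvexOn (hf : IsLSmooth L f) (hL : 0 < L) (hd : 0 < d)
    {h μ : ℝ} (hh : 0 ≤ h) (hhL : h ≤ 1 / L) (hμ : 0 < μ) (hc : StrongConvexOn Set.univ μ f)
    (x y : RVec d) :
    ‖(x - h • gradient f x) - (y - h • gradient f y)‖ ≤ (1 - h * μ / 2) * ‖x - y‖ := by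
  have hhL' : h * L ≤ 1 := by rwa [le_div_iff₀ hL] at hhL
  have hμL := hf.strongConvexity_le hd hc
  have hq : h * μ ≤ 1 := (mul_le_mul_of_nonneg_left hμL hh).trans hhL'
  rw [show (x - h • gradient f x) - (y - h • gradient f y) =
    (x - y) - h • (gradient f x - gradient f y) by module]
  refine abs_le_of_sq_le_sq' ?_ (mul_nonneg (by linarith) (norm_nonneg _)) |>.2
  have h1 := hf.strong_monotone hc x y
  have h2 := hf.norm_gradient_sub_sq_le hL (hc.mono hμ.le) x y
  rw [norm_sub_sq_real, norm_smul, inner_smul_right, real_inner_comm, Real.norm_eq_abs, mul_pow,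
    sq_abs]
  set I := ⟪gradient f x - gradient f y, x - y⟫
  have hI : 0 ≤ I := le_trans (by positivity) h1
  have h3 : h ^ 2 * ‖gradient f x - gradient f y‖ ^ 2 ≤ h * I := by
    calc _ ≤ h ^ 2 * (L * I) := mul_le_mul_of_nonneg_left h2 (sq_nonneg h)
      _ = (h * L) * (h * I) := by ring
      _ ≤ 1 * (h * I) := mul_le_mul_of_nonneg_right hhL' (mul_nonneg hh hI)
      _ = _ := one_mul _
  have h4 := mul_le_mul_of_nonneg_left h1 hh
  nlinarith [sq_nonneg (h * μ * ‖x - y‖)]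

end IsLSmooth

/-! ### The Gaussian density and importance weighting -/

theorem stepDensity_pos {d : ℕ} {h : ℝ} (hh : 0 < h) (ξ : RVec d) : 0 < stepDensity h ξ := by
  unfold stepDensity; positivity

theorem continuous_stepDensity {d : ℕ} (h : ℝ) : Continuous (stepDensity (d := d) h) := by
  unfold stepDensity; fun_prop

/-- At `h = 1/2` the variance `2h` is one, so `stepDensity` is the standard Gaussian density. Both
measures have the same characteristic function. -/
theorem stdGaussian_eq_withDensity (d : ℕ) :
    stdGaussian (RVec d) = (volume : Measure (RVec d)).withDensity
      fun x => ENNReal.ofReal (stepDensity (1 / 2) x) := by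
  have hint : Integrable (fun x : RVec d => stepDensity (1 / 2) x) := by
    have h0 := GaussianFourier.integrable_cexp_neg_mul_sq_norm_add (V := RVec d) (b := 1 / 2)
      (by norm_num) 0 0
    refine (h0.norm.const_mul (1 / (4 * Real.pi * (1 / 2)) ^ ((d : ℝ) / 2))).congr
      (Filter.Eventually.of_forall fun x => ?_)
    simp only [stepDensity, Complex.norm_exp]
    congr 2
    simp [← Complex.ofReal_pow]
    ring
  have hfin := isFiniteMeasure_withDensity_ofReal hint.2
  refine Measure.ext_of_charFun (E := RVec d) ?_
  ext t
  rw [charFun_stdGaussian, charFun_apply, integral_withDensity_eq_integral_toReal_smul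
    (continuous_stepDensity _).measurable.ennreal_ofReal (by simp)]
  have hG := GaussianFourier.integral_cexp_neg_mul_sq_norm_add (V := RVec d) (b := 1 / 2)
    (by norm_num) Complex.I t
  have e : ∀ x : RVec d, (ENNReal.ofReal (stepDensity (1 / 2) x)).toReal •
      Complex.exp (⟪x, t⟫ * Complex.I) = ((1 / (2 * Real.pi) ^ ((d : ℝ) / 2) : ℝ) : ℂ) *
        Complex.exp (-(1 / 2) * ‖x‖ ^ 2 + Complex.I * ⟪t, x⟫) := by
    intro x
    rw [ENNReal.toReal_ofReal (stepDensity_pos (by norm_num) x).le, stepDensity, Complex.real_smul,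
      Complex.ofReal_mul, Complex.ofReal_exp, mul_assoc, ← Complex.exp_add, real_inner_comm]
    rw [show 4 * Real.pi * (1 / 2) = 2 * Real.pi by ring]
    congr 2
    push_cast; ring
  simp_rw [e]
  rw [integral_const_mul, hG, finrank_euclideanSpace_fin]
  have hp : ((Real.pi : ℂ) / (1 / 2)) ^ ((d : ℂ) / 2) =
      (((2 * Real.pi) ^ ((d : ℝ) / 2) : ℝ) : ℂ) := by
    rw [Complex.ofReal_cpow (by positivity)]
    congr 1
    · push_cast; ring
    · push_cast; ring
  rw [hp, ← mul_assoc, ← Complex.ofReal_mul, one_div_mul_cancel (by positivity), Complex.ofReal_one,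
    one_mul, Complex.I_sq]
  congr 1
  ring

/-- The density of `ξ` divided by that of `w + √(2h) ξ` is `(2h)^{d/2}`, the Jacobian of `ξ ↦ w +
√(2h) ξ`. The result does not depend on `w`. -/
theorem lintegral_importance {d : ℕ} {h : ℝ} (hh : 0 < h) (w : RVec d) (φ : RVec d → ℝ≥0∞)
    (hφ : Measurable φ) :
    ∫⁻ ξ, ENNReal.ofReal (1 / stepDensity h ξ) * φ (w + √(2 * h) • ξ) ∂stdGaussian (RVec d) =
      ∫⁻ y, φ y := by
  have hs : 0 < √(2 * h) := by positivity
  rw [stdGaussian_eq_withDensity, lintegral_withDensity_eq_lintegral_mul _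
    (continuous_stepDensity _).measurable.ennreal_ofReal]
  swap
  · have := (continuous_stepDensity (d := d) h).measurable
    fun_prop
  have e : ∀ ξ : RVec d, ENNReal.ofReal (stepDensity (1 / 2) ξ) *
      (ENNReal.ofReal (1 / stepDensity h ξ) * φ (w + √(2 * h) • ξ)) =
      ENNReal.ofReal (√(2 * h) ^ d) * φ (w + √(2 * h) • ξ) := by
    intro ξ
    have hd : √(2 * h) ^ d = (2 * h) ^ ((d : ℝ) / 2) := by
      rw [Real.sqrt_eq_rpow, ← Real.rpow_mul_natCast (by positivity)]
      congr 1; ring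
    rw [← mul_assoc, ← ENNReal.ofReal_mul (stepDensity_pos (by norm_num) ξ).le]
    congr 2
    have hm : (4 * Real.pi * h) ^ ((d : ℝ) / 2) =
        (4 * Real.pi * (1 / 2)) ^ ((d : ℝ) / 2) * (2 * h) ^ ((d : ℝ) / 2) := by
      rw [← Real.mul_rpow (by positivity) (by positivity)]
      congr 1; ring
    rw [hd, stepDensity, stepDensity, hm]
    have h1 : (4 * Real.pi * (1 / 2)) ^ ((d : ℝ) / 2) ≠ 0 := by positivity
    generalize (4 * Real.pi * (1 / 2)) ^ ((d : ℝ) / 2) = A at h1 ⊢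
    field_simp
  simp only [Pi.mul_apply, e]
  rw [lintegral_const_mul _ (by fun_prop)]
  have h1 : ∫⁻ ξ : RVec d, φ (w + √(2 * h) • ξ) =
      ∫⁻ y, φ (w + y) ∂(Measure.map (fun ξ : RVec d => √(2 * h) • ξ) volume) := by
    rw [lintegral_map (by fun_prop) (by fun_prop)]
  rw [h1, Measure.map_addHaar_smul _ hs.ne', lintegral_smul_measure, smul_eq_mul, ← mul_assoc,
    finrank_euclideanSpace_fin, ← ENNReal.ofReal_mul (by positivity), abs_of_nonneg (by positivity),
    mul_inv_cancel₀ (by positivity), ENNReal.ofReal_one, one_mul, lintegral_add_left_eq_self]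

/-! ### Isotropy: the average of `u uᵀ/|u|²` over a centred ball -/

theorem abs_coord_mul_coord_div_le {d : ℕ} (j k : Fin d) (u : RVec d) :
    |u j * u k / ‖u‖ ^ 2| ≤ 1 := by
  rw [abs_div, abs_mul, abs_of_nonneg (sq_nonneg ‖u‖)]
  refine div_le_one_of_le₀ ?_ (sq_nonneg _)
  rw [sq]
  exact mul_le_mul (PiLp.norm_apply_le u j) (PiLp.norm_apply_le u k) (abs_nonneg _) (norm_nonneg _)

theorem integrableOn_coord_mul_coord_div {d : ℕ} (η : ℝ) (j k : Fin d) :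
    IntegrableOn (fun u : RVec d => u j * u k / ‖u‖ ^ 2) (Metric.closedBall 0 η) := by
  refine Measure.integrableOn_of_bounded (M := 1) (measure_closedBall_lt_top).ne
    (Measurable.aestronglyMeasurable (by fun_prop)) ?_
  exact Filter.Eventually.of_forall fun u => abs_coord_mul_coord_div_le j k u

theorem setIntegral_closedBall_comp {d : ℕ} (η : ℝ) (e : RVec d ≃ₗᵢ[ℝ] RVec d) (φ : RVec d → ℝ) :
    ∫ u in Metric.closedBall 0 η, φ (e u) = ∫ u in Metric.closedBall 0 η, φ u := by
  have := e.measurePreserving.setIntegral_preimage_emb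
    e.toHomeomorph.measurableEmbedding φ (Metric.closedBall 0 η)
  rwa [LinearIsometryEquiv.preimage_closedBall, map_zero] at this

theorem setIntegral_coord_mul_coord_div_of_ne {d : ℕ} (η : ℝ) {j k : Fin d} (hjk : j ≠ k) :
    ∫ u in Metric.closedBall (0 : RVec d) η, u j * u k / ‖u‖ ^ 2 = 0 := by
  -- The reflection in coordinate `j` preserves the ball and changes the sign of the integrand.
  have h := setIntegral_closedBall_comp η (LinearIsometryEquiv.piLpCongrRight 2 fun l : Fin d =>
    if l = j then LinearIsometryEquiv.neg ℝ (E := ℝ) else LinearIsometryEquiv.refl ℝ ℝ)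
    (fun u => u j * u k / ‖u‖ ^ 2)
  simp only [LinearIsometryEquiv.norm_map] at h
  simp only [LinearIsometryEquiv.piLpCongrRight_apply, if_true, hjk.symm, if_false,
    LinearIsometryEquiv.coe_neg, LinearIsometryEquiv.coe_refl, id] at h
  simp only [neg_mul, neg_div, integral_neg] at h
  linarith

theorem setIntegral_coord_sq_div_eq {d : ℕ} (η : ℝ) (j k : Fin d) :
    ∫ u in Metric.closedBall (0 : RVec d) η, u j * u j / ‖u‖ ^ 2 =
      ∫ u in Metric.closedBall (0 : RVec d) η, u k * u k / ‖u‖ ^ 2 := by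
  have h := setIntegral_closedBall_comp η
    (LinearIsometryEquiv.piLpCongrLeft 2 ℝ ℝ (Equiv.swap j k)) (fun u => u k * u k / ‖u‖ ^ 2)
  simp only [LinearIsometryEquiv.norm_map] at h
  simpa [LinearIsometryEquiv.piLpCongrLeft_apply] using h

/-- The `d` diagonal integrals agree by permuting coordinates, and their integrands sum to one away
from the origin. -/
theorem setIntegral_coord_sq_div {d : ℕ} (η : ℝ) (k : Fin d) :
    ∫ u in Metric.closedBall (0 : RVec d) η, u k * u k / ‖u‖ ^ 2 =
      (volume : Measure (RVec d)).real (Metric.closedBall 0 η) / d := by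
  have hd : (d : ℝ) ≠ 0 := by
    have := k.pos
    positivity
  have : NeZero d := ⟨k.pos.ne'⟩
  have h1 : ∑ j : Fin d, ∫ u in Metric.closedBall (0 : RVec d) η, u j * u j / ‖u‖ ^ 2 =
      (volume : Measure (RVec d)).real (Metric.closedBall 0 η) := by
    rw [← integral_finsetSum _ fun j _ => integrableOn_coord_mul_coord_div η j j]
    have h2 : ∀ᵐ u : RVec d ∂(volume.restrict (Metric.closedBall 0 η)),
        ∑ j, u j * u j / ‖u‖ ^ 2 = 1 := by
      refine ae_restrict_of_ae ?_
      filter_upwards [Measure.ae_ne volume (0 : RVec d)] with u hu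
      rw [← Finset.sum_div, EuclideanSpace.real_norm_sq_eq, div_eq_one_iff_eq]
      · simp [sq]
      · rw [← EuclideanSpace.real_norm_sq_eq]
        positivity
    rw [integral_congr_ae h2]
    simp
  rw [Finset.sum_congr rfl fun j _ => setIntegral_coord_sq_div_eq η j k] at h1
  rw [← h1]
  simp
  field_simp

/-- This identity dictates the normalization `α_d = d/V`. -/
theorem setIntegral_inner_mul_coord_div {d : ℕ} (η : ℝ) (g : RVec d) (k : Fin d) :
    ∫ u in Metric.closedBall (0 : RVec d) η, ⟪g, u⟫ * u k / ‖u‖ ^ 2 =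
      (volume : Measure (RVec d)).real (Metric.closedBall 0 η) / d * g k := by
  have e : ∀ u : RVec d, ⟪g, u⟫ * u k / ‖u‖ ^ 2 = ∑ j, g j * (u j * u k / ‖u‖ ^ 2) := by
    intro u
    rw [PiLp.inner_apply, Finset.sum_mul, Finset.sum_div]
    refine Finset.sum_congr rfl fun j _ => ?_
    simp
    ring
  simp_rw [e]
  rw [integral_finsetSum _ fun j _ => (integrableOn_coord_mul_coord_div η j k).const_mul _]
  simp_rw [integral_const_mul]
  rw [Finset.sum_eq_single k]
  · rw [setIntegral_coord_sq_div, mul_comm]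
  · intro j _ hj
    rw [setIntegral_coord_mul_coord_div_of_ne η hj, mul_zero]
  · simp

/-! ### Product measures: conditioning on one coordinate, variance of an average -/

/-- Conditioning on `ξ i` without splitting the product: the inner integral still runs over all
coordinates, the `i`-th being overwritten by `a`. -/
theorem lintegral_pi_eq_lintegral_update {ι E : Type*} [Fintype ι] [DecidableEq ι]
    [MeasurableSpace E] (μ : Measure E) [IsProbabilityMeasure μ] (i : ι) {G : (ι → E) → ℝ≥0∞}
    (hG : Measurable G) :
    ∫⁻ ξ, G ξ ∂Measure.pi (fun _ => μ) =
      ∫⁻ a, ∫⁻ ξ, G (Function.update ξ i a) ∂Measure.pi (fun _ => μ) ∂μ := by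
  have hu : Measurable fun q : E × (ι → E) => Function.update q.2 i q.1 := by
    refine measurable_pi_lambda _ fun j => ?_
    by_cases hj : j = i
    · subst hj; simpa using measurable_fst
    · simp only [Function.update_of_ne hj]
      fun_prop
  rw [← lintegral_lintegral_swap (f := fun ξ a => G (Function.update ξ i a))
    ((hG.comp (hu.comp measurable_swap)).aemeasurable)]
  refine lintegral_eq_of_lmarginal_eq (μ := fun _ => μ) {i} hG
    (Measurable.lintegral_prod_right' (f := fun q : (ι → E) × E => G (Function.update q.1 i q.2))
      (hG.comp (hu.comp measurable_swap))) ?_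
  rw [lmarginal_singleton, lmarginal_singleton]
  simp

theorem lintegral_enorm_le_of_lintegral_sq_le {Ω E : Type*} [MeasurableSpace Ω]
    [NormedAddCommGroup E] {μ : Measure Ω} [IsProbabilityMeasure μ] {V : Ω → E}
    (hV : AEStronglyMeasurable V μ) {B : ℝ} (h : ∫⁻ ω, ‖V ω‖ₑ ^ 2 ∂μ ≤ ENNReal.ofReal B) :
    ∫⁻ ω, ‖V ω‖ₑ ∂μ ≤ ENNReal.ofReal √B := by
  have h1 := eLpNorm_le_eLpNorm_of_exponent_le (p := 1) (q := 2) (by norm_num) hV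
  rw [eLpNorm_one_eq_lintegral_enorm, eLpNorm_eq_lintegral_rpow_enorm_toReal (by norm_num)
    (by norm_num)] at h1
  refine h1.trans ?_
  simp only [ENNReal.toReal_ofNat, ENNReal.rpow_ofNat]
  refine (ENNReal.rpow_le_rpow h (by norm_num)).trans ?_
  rcases le_or_gt 0 B with hB | hB
  · rw [ENNReal.ofReal_rpow_of_nonneg hB (by norm_num), Real.sqrt_eq_rpow]
  · rw [ENNReal.ofReal_of_nonpos hB.le]; simp

/-- Coordinate by coordinate, variances of independent terms add and each is at most a second
moment. The bounds `b` serve only for integrability. -/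
theorem integral_norm_average_sub_sq_le {ι E : Type*} [Fintype ι] [DecidableEq ι]
    [MeasurableSpace E] (μ : Measure E) [IsProbabilityMeasure μ] {d : ℕ} (S : Finset ι)
    (hS : S.Nonempty) (A : ι → E → RVec d) (hA : ∀ j, Measurable (A j)) (b : ι → ℝ)
    (hb : ∀ j ∈ S, ∀ ξ, ‖A j ξ‖ ≤ b j) (g : RVec d) (hg : ∀ j ∈ S, ∀ k, ∫ ξ, A j ξ k ∂μ = g k)
    {K : ℝ} (hK : ∀ j ∈ S, ∫ ξ, ‖A j ξ‖ ^ 2 ∂μ ≤ K) :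
    Integrable (fun ξ : ι → E => ‖(1 / (S.card : ℝ)) • ∑ j ∈ S, A j (ξ j) - g‖ ^ 2)
        (Measure.pi fun _ => μ) ∧
      ∫ ξ, ‖(1 / (S.card : ℝ)) • ∑ j ∈ S, A j (ξ j) - g‖ ^ 2 ∂Measure.pi (fun _ => μ) ≤
        K / S.card := by
  have hn : (S.card : ℝ) ≠ 0 := by simpa using hS.ne_empty
  set n : ℝ := (S.card : ℝ) with hn_def
  -- Extension by zero outside `S`, so that `variance_sum_pi` applies over the whole index type.
  let X : Fin d → ι → E → ℝ := fun k j ξ => if j ∈ S then 1 / n * A j ξ k else 0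
  have hXm : ∀ k j, Measurable (X k j) := by
    intro k j
    by_cases hj : j ∈ S <;> simp only [X, hj, if_true, if_false]
    · have := hA j; fun_prop
    · fun_prop
  have hAk : ∀ k, ∀ j ∈ S, MemLp (fun ξ => A j ξ k) 2 μ := by
    intro k j hj
    refine MemLp.of_bound (Measurable.aestronglyMeasurable (by have := hA j; fun_prop)) (b j)
      (Filter.Eventually.of_forall fun ξ => ?_)
    exact (PiLp.norm_apply_le _ k).trans (hb j hj ξ)
  have hX : ∀ k j, MemLp (X k j) 2 μ := by
    intro k j
    by_cases hj : j ∈ S <;> simp only [X, hj, if_true, if_false]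
    · exact (hAk k j hj).const_mul _
    · exact MemLp.zero'
  have hX' : ∀ k j, MemLp (fun ξ : ι → E => X k j (ξ j)) 2 (Measure.pi fun _ => μ) := fun k j =>
    (hX k j).comp_measurePreserving (measurePreserving_eval _ j)
  have hsum : ∀ k (ξ : ι → E), ((1 / n) • ∑ j ∈ S, A j (ξ j) - g) k = ∑ j, X k j (ξ j) - g k := by
    intro k ξ
    simp only [X, PiLp.sub_apply, PiLp.smul_apply, WithLp.ofLp_sum, Finset.sum_apply, smul_eq_mul,
      Finset.mul_sum, Finset.sum_ite_mem, Finset.univ_inter]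
  have hmean : ∀ k, ∫ ξ : ι → E, ∑ j, X k j (ξ j) ∂Measure.pi (fun _ => μ) = g k := by
    intro k
    rw [integral_finsetSum _ fun j _ => (hX' k j).integrable (by norm_num)]
    have : ∀ j, ∫ ξ : ι → E, X k j (ξ j) ∂Measure.pi (fun _ => μ) =
        if j ∈ S then 1 / n * g k else 0 := by
      intro j
      rw [integral_comp_eval (hXm k j).aestronglyMeasurable]
      by_cases hj : j ∈ S <;> simp only [X, hj, if_true, if_false]
      · rw [integral_const_mul, hg j hj]
      · simp
    simp_rw [this]
    rw [Finset.sum_ite_mem, Finset.univ_inter, Finset.sum_const, nsmul_eq_mul, ← hn_def]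
    field_simp
  have hsq : ∀ k, MemLp (fun ξ : ι → E => ∑ j, X k j (ξ j) - g k) 2 (Measure.pi fun _ => μ) :=
    fun k => (memLp_finsetSum _ fun j _ => hX' k j).sub (memLp_const _)
  have hvar : ∀ k, ∫ ξ : ι → E, (∑ j, X k j (ξ j) - g k) ^ 2 ∂Measure.pi (fun _ => μ) ≤
      ∑ j ∈ S, (1 / n) ^ 2 * ∫ ξ, (A j ξ k) ^ 2 ∂μ := by
    intro k
    have h1 := variance_sum_pi (μ := fun _ : ι => μ) (hX k)
    rw [variance_eq_integral (Finset.aemeasurable_sum (f := fun j (ξ : ι → E) => X k j (ξ j)) _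
      fun j _ => ((hXm k j).comp (measurable_pi_apply j)).aemeasurable)] at h1
    simp only [Finset.sum_apply, hmean] at h1
    rw [h1, ← Finset.sum_subset (Finset.subset_univ S)]
    · refine Finset.sum_le_sum fun j hj => ?_
      simp only [X, hj, if_true]
      rw [variance_const_mul]
      refine mul_le_mul_of_nonneg_left ?_ (sq_nonneg _)
      exact variance_le_expectation_sq (hAk k j hj).aestronglyMeasurable
    · intro j _ hj
      simp only [X, hj, if_false]
      exact variance_zero μ
  have hnorm : ∀ ξ : ι → E, ‖(1 / n) • ∑ j ∈ S, A j (ξ j) - g‖ ^ 2 =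
      ∑ k, (∑ j, X k j (ξ j) - g k) ^ 2 := by
    intro ξ
    rw [EuclideanSpace.real_norm_sq_eq]
    exact Finset.sum_congr rfl fun k _ => by rw [hsum]
  simp_rw [hnorm]
  refine ⟨integrable_finsetSum _ fun k _ => (hsq k).integrable_sq, ?_⟩
  rw [integral_finsetSum _ fun k _ => (hsq k).integrable_sq]
  calc ∑ k, ∫ ξ : ι → E, (∑ j, X k j (ξ j) - g k) ^ 2 ∂Measure.pi (fun _ => μ)
      ≤ ∑ k, ∑ j ∈ S, (1 / n) ^ 2 * ∫ ξ, (A j ξ k) ^ 2 ∂μ := Finset.sum_le_sum fun k _ => hvar k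
    _ = ∑ j ∈ S, (1 / n) ^ 2 * ∫ ξ, ‖A j ξ‖ ^ 2 ∂μ := by
        rw [Finset.sum_comm]
        refine Finset.sum_congr rfl fun j hj => ?_
        rw [← Finset.mul_sum, ← integral_finsetSum _ fun k _ => (hAk k j hj).integrable_sq]
        simp_rw [EuclideanSpace.real_norm_sq_eq]
    _ ≤ ∑ j ∈ S, (1 / n) ^ 2 * K := Finset.sum_le_sum fun j hj =>
        mul_le_mul_of_nonneg_left (hK j hj) (sq_nonneg _)
    _ = K / n := by
        rw [Finset.sum_const, nsmul_eq_mul, ← hn_def]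
        field_simp

/-! ### Pair forces: unbiased linear part, second moment and Taylor remainder -/

theorem map_withDensity_inv_stepDensity {d : ℕ} {h : ℝ} (hh : 0 < h) (w : RVec d) :
    ((stdGaussian (RVec d)).withDensity fun ξ => ENNReal.ofReal (1 / stepDensity h ξ)).map
      (fun ξ => w + √(2 * h) • ξ) = volume := by
  have hm : Measurable fun ξ : RVec d => ENNReal.ofReal (1 / stepDensity h ξ) := by
    have := (continuous_stepDensity (d := d) h).measurable
    fun_prop
  refine Measure.ext_of_lintegral _ fun φ hφ => ?_
  rw [lintegral_map hφ (by fun_prop), lintegral_withDensity_eq_lintegral_mul _ hm (by fun_prop)]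
  exact lintegral_importance hh w φ hφ

theorem integral_importance {d : ℕ} {h : ℝ} (hh : 0 < h) (w : RVec d) {φ : RVec d → ℝ}
    (hφ : Measurable φ) :
    ∫ ξ, 1 / stepDensity h ξ * φ (w + √(2 * h) • ξ) ∂stdGaussian (RVec d) = ∫ y, φ y := by
  have hm : Measurable fun ξ : RVec d => ENNReal.ofReal (1 / stepDensity h ξ) := by
    have := (continuous_stepDensity (d := d) h).measurable
    fun_prop
  rw [← map_withDensity_inv_stepDensity hh w, integral_map (by fun_prop)
    hφ.aestronglyMeasurable, integral_withDensity_eq_integral_toReal_smul hm (by simp)]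
  refine integral_congr_ae (Filter.Eventually.of_forall fun ξ => ?_)
  have := stepDensity_pos hh ξ
  simp only [smul_eq_mul]
  rw [ENNReal.toReal_ofReal (by positivity)]

theorem alphaConst_nonneg (d : ℕ) (η : ℝ) : 0 ≤ alphaConst d η := by
  unfold alphaConst; positivity

theorem volume_real_closedBall_pos {d : ℕ} {η : ℝ} (hη : 0 < η) (x : RVec d) :
    0 < (volume : Measure (RVec d)).real (Metric.closedBall x η) :=
  ENNReal.toReal_pos (Metric.measure_closedBall_pos volume x hη).ne' measure_closedBall_lt_top.ne

theorem volume_real_closedBall_eq {d : ℕ} (η : ℝ) (x : RVec d) :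
    (volume : Measure (RVec d)).real (Metric.closedBall x η) =
      (volume : Measure (RVec d)).real (Metric.closedBall 0 η) := by
  simp only [Measure.real, Measure.addHaar_closedBall_center]

theorem alphaConst_mul_volume {d : ℕ} {η : ℝ} (hη : 0 < η) (x : RVec d) :
    alphaConst d η * (volume : Measure (RVec d)).real (Metric.closedBall x η) = d := by
  rw [volume_real_closedBall_eq, alphaConst, div_mul_cancel₀]
  exact (volume_real_closedBall_pos hη 0).ne'

/-- The contribution of a particle at `y`, whose last noise was `ξ`, to the ensemble approximation
at `x` of the gradient of the linear function with gradient `g`. -/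
def linForce {d : ℕ} (h η : ℝ) (g x y ξ : RVec d) : RVec d :=
  if ‖y - x‖ ≤ η then
    (alphaConst d η * (⟪g, y - x⟫ / ‖y - x‖ ^ 2) / stepDensity h ξ) • (y - x)
  else 0

theorem measurable_linForce {d : ℕ} {α : Type*} [MeasurableSpace α] (h η : ℝ)
    {g x y ξ : α → RVec d} (hg : Measurable g) (hx : Measurable x) (hy : Measurable y)
    (hξ : Measurable ξ) : Measurable fun a => linForce h η (g a) (x a) (y a) (ξ a) := by
  have := (continuous_stepDensity (d := d) h).measurable
  unfold linForce
  refine Measurable.ite (measurableSet_le (by fun_prop) measurable_const) ?_ measurable_const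
  fun_prop

theorem norm_linForce_le {d : ℕ} {h : ℝ} (hh : 0 < h) (η : ℝ) (g x y ξ : RVec d) :
    ‖linForce h η g x y ξ‖ ≤
      1 / stepDensity h ξ * (Metric.closedBall x η).indicator (fun _ => alphaConst d η * ‖g‖) y := by
  have hp := stepDensity_pos hh ξ
  have hα := alphaConst_nonneg d η
  unfold linForce
  by_cases hy : ‖y - x‖ ≤ η
  · rw [if_pos hy, Set.indicator_of_mem (by rwa [mem_closedBall_iff_norm]), norm_smul, norm_div,
      norm_mul, norm_div, Real.norm_of_nonneg hp.le, Real.norm_of_nonneg hα, norm_pow, norm_norm]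
    have h1 : ‖⟪g, y - x⟫‖ / ‖y - x‖ ^ 2 * ‖y - x‖ ≤ ‖g‖ := by
      rcases eq_or_ne (y - x) 0 with h0 | h0
      · simp [h0]
      · have h0' : 0 < ‖y - x‖ := norm_pos_iff.2 h0
        rw [div_mul_eq_mul_div, div_le_iff₀ (by positivity)]
        nlinarith [norm_inner_le_norm (𝕜 := ℝ) g (y - x)]
    calc _ = 1 / stepDensity h ξ * (alphaConst d η * (‖⟪g, y - x⟫‖ / ‖y - x‖ ^ 2 * ‖y - x‖)) := by
          ring
      _ ≤ _ := by gcongr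
  · rw [if_neg hy, norm_zero]
    exact mul_nonneg (by positivity) (Set.indicator_nonneg (fun _ _ => by positivity) _)

/-- Unbiasedness: the weight makes `y` Lebesgue distributed, and isotropy of the ball around `x`
recovers `g`. -/
theorem integral_linForce_coord {d : ℕ} {h η : ℝ} (hh : 0 < h) (hη : 0 < η) (g x w : RVec d)
    (k : Fin d) :
    ∫ ξ, linForce h η g x (w + √(2 * h) • ξ) ξ k ∂stdGaussian (RVec d) = g k := by
  have hd : (d : ℝ) ≠ 0 := by
    have := k.pos
    positivity
  let ψ : RVec d → ℝ := (Metric.closedBall 0 η).indicator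
    fun u => alphaConst d η * (⟪g, u⟫ * u k / ‖u‖ ^ 2)
  have hψ : Measurable ψ := by
    refine Measurable.indicator ?_ measurableSet_closedBall
    fun_prop
  have e : ∀ ξ : RVec d, linForce h η g x (w + √(2 * h) • ξ) ξ k =
      1 / stepDensity h ξ * ψ (w + √(2 * h) • ξ - x) := by
    intro ξ
    simp only [linForce, ψ, Set.indicator, mem_closedBall_zero_iff]
    split_ifs
    · simp only [PiLp.smul_apply, smul_eq_mul]
      ring
    · simp
  simp_rw [e]
  rw [integral_importance hh w (φ := fun y => ψ (y - x)) (by fun_prop),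
    integral_sub_right_eq_self ψ x, integral_indicator measurableSet_closedBall, integral_const_mul,
    setIntegral_inner_mul_coord_div, alphaConst]
  have := (volume_real_closedBall_pos (d := d) hη 0).ne'
  field_simp

/-- Of the two weights `1/p` in the square, one is bounded by `M` and the other turns the integral
into the volume of the `η`-ball, which cancels one factor `α_d`. -/
theorem integral_norm_linForce_sq_le {d : ℕ} {h η : ℝ} (hh : 0 < h) (hη : 0 < η) (g x w : RVec d)
    {M : ℝ} (hM : ∀ ξ : RVec d, ‖w + √(2 * h) • ξ - x‖ ≤ η → 1 / stepDensity h ξ ≤ M) :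
    ∫ ξ, ‖linForce h η g x (w + √(2 * h) • ξ) ξ‖ ^ 2 ∂stdGaussian (RVec d) ≤
      alphaConst d η * d * ‖g‖ ^ 2 * M := by
  set c := alphaConst d η * ‖g‖
  have hc : 0 ≤ c := mul_nonneg (alphaConst_nonneg _ _) (norm_nonneg _)
  let φ : RVec d → ℝ := (Metric.closedBall x η).indicator fun _ => c ^ 2 * M
  have hφ : Measurable φ := measurable_const.indicator measurableSet_closedBall
  have hm := (continuous_stepDensity (d := d) h).measurable
  have hle : ∀ ξ : RVec d, ‖linForce h η g x (w + √(2 * h) • ξ) ξ‖ ^ 2 ≤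
      1 / stepDensity h ξ * φ (w + √(2 * h) • ξ) := by
    intro ξ
    have hp := stepDensity_pos hh ξ
    refine (pow_le_pow_left₀ (norm_nonneg _) (norm_linForce_le hh η g x _ ξ) 2).trans ?_
    simp only [φ, Set.indicator, mem_closedBall_iff_norm]
    split_ifs with hy
    · calc _ = 1 / stepDensity h ξ * (c ^ 2 * (1 / stepDensity h ξ)) := by ring
        _ ≤ _ := by have := hM ξ hy; gcongr
    · simp
  have hint : Integrable (fun ξ : RVec d => 1 / stepDensity h ξ * φ (w + √(2 * h) • ξ))
      (stdGaussian (RVec d)) := by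
    refine Integrable.of_bound (Measurable.aestronglyMeasurable (by fun_prop)) (c ^ 2 * M ^ 2)
      (Filter.Eventually.of_forall fun ξ => ?_)
    have hp := stepDensity_pos hh ξ
    simp only [φ, Set.indicator, mem_closedBall_iff_norm]
    split_ifs with hy
    · have h1 := hM ξ hy
      have hM0 : 0 ≤ M := le_trans (by positivity) h1
      rw [Real.norm_of_nonneg (by positivity)]
      calc 1 / stepDensity h ξ * (c ^ 2 * M) ≤ M * (c ^ 2 * M) := by gcongr
        _ = _ := by ring
    · simp; positivity
  refine (integral_mono_of_nonneg (Filter.Eventually.of_forall fun ξ => sq_nonneg _) hint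
    (Filter.Eventually.of_forall hle)).trans ?_
  rw [integral_importance hh w hφ, integral_indicator_const _ measurableSet_closedBall, smul_eq_mul,
    ← alphaConst_mul_volume hη x]
  refine le_of_eq ?_
  simp only [c]
  ring

/-- If both the endpoints and the centres are within `R₂`, then `√(2h) |ξ| ≤ √(2h) |a| + 2 R₂`;
squaring compares the exponents. Keeping the factor `1 / stepDensity h a`, instead of bounding it
uniformly, allows it to be integrated exactly later. -/
theorem inv_stepDensity_le {d : ℕ} {h R₁ R₂ η : ℝ} (hh : 0 < h) (hη : η ≤ R₂) (hR : 0 ≤ R₂)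
    {v w a ξ : RVec d} (ha : √(2 * h) * ‖a‖ ≤ R₁) (hw : ‖v - w‖ ≤ R₂)
    (hξ : ‖v + √(2 * h) • ξ - (w + √(2 * h) • a)‖ ≤ η) :
    1 / stepDensity h ξ ≤ 1 / stepDensity h a * Real.exp (R₂ * (R₂ + R₁) / h) := by
  have hs : √(2 * h) ^ 2 = 2 * h := Real.sq_sqrt (by positivity)
  set s := √(2 * h)
  have hs0 : 0 ≤ s := Real.sqrt_nonneg _
  have h1 : s * ‖ξ‖ ≤ s * ‖a‖ + 2 * R₂ := by
    have e : s • ξ = (v + s • ξ - (w + s • a)) + s • a - (v - w) := by abel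
    have e' : s * ‖ξ‖ = ‖s • ξ‖ := by rw [norm_smul, Real.norm_of_nonneg hs0]
    have e'' : s * ‖a‖ = ‖s • a‖ := by rw [norm_smul, Real.norm_of_nonneg hs0]
    rw [e', e'', e]
    refine (norm_sub_le _ _).trans ?_
    linarith [norm_add_le (v + s • ξ - (w + s • a)) (s • a)]
  have h2 : (s * ‖ξ‖) ^ 2 ≤ (s * ‖a‖ + 2 * R₂) ^ 2 :=
    pow_le_pow_left₀ (by positivity) h1 2
  have h3 : h * ‖ξ‖ ^ 2 ≤ h * ‖a‖ ^ 2 + 2 * (R₂ * (R₂ + R₁)) := by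
    rw [mul_pow, hs] at h2
    have h4 : (s * ‖a‖ + 2 * R₂) ^ 2 = 2 * h * ‖a‖ ^ 2 + 4 * R₂ * (s * ‖a‖) + 4 * R₂ ^ 2 := by
      rw [← hs]; ring
    nlinarith [mul_le_mul_of_nonneg_left ha hR]
  have h5 : ‖ξ‖ ^ 2 / 2 ≤ ‖a‖ ^ 2 / 2 + R₂ * (R₂ + R₁) / h := by
    rw [← mul_le_mul_iff_of_pos_left hh, mul_add, mul_div_cancel₀ _ hh.ne']
    linarith
  have e : ∀ b : RVec d, 1 / stepDensity h b =
      (4 * Real.pi * h) ^ ((d : ℝ) / 2) * Real.exp (‖b‖ ^ 2 / 2) := by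
    intro b
    rw [stepDensity, neg_div, Real.exp_neg]
    field_simp
  rw [e, e, mul_assoc _ (Real.exp _), ← Real.exp_add]
  gcongr

theorem neighborCount_eq_card {d N : ℕ} (R₂ : ℝ) (w : Fin N → RVec d) (i : Fin N) :
    neighborCount R₂ w i = {j ∈ Finset.univ.erase i | ‖w j - w i‖ ≤ R₂}.card := by
  rw [neighborCount, ← Set.ncard_coe_finset]
  congr 1
  ext j
  simp

theorem norm_pairForce_sub_linForce_le {d N : ℕ} {f : RVec d → ℝ} {L : ℝ} (hf : IsLSmooth L f)
    (hL : 0 ≤ L) (p : CEnLMCParams) (hh : 0 < p.h) (x w ξ : Fin N → RVec d) {i j : Fin N}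
    (hj : ‖w j - w i‖ ≤ p.R₂) :
    ‖pairForce f p x w ξ i j - linForce p.h p.η (gradient f (x i)) (x i) (x j) (ξ j)‖ ≤
      1 / stepDensity p.h (ξ j) * (Metric.closedBall (x i) p.η).indicator
        (fun _ => alphaConst d p.η * (L * p.η / 2)) (x j) := by
  have hp := stepDensity_pos hh (ξ j)
  have hα := alphaConst_nonneg d p.η
  unfold pairForce linForce
  by_cases hy : ‖x j - x i‖ ≤ p.η
  · rw [if_pos ⟨hy, hj⟩, if_pos hy, Set.indicator_of_mem (by rwa [mem_closedBall_iff_norm])]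
    have hη : 0 ≤ p.η := (norm_nonneg _).trans hy
    set u := x j - x i with hu
    set r := f (x j) - f (x i) - ⟪gradient f (x i), u⟫ with hr
    have h0 : |r| ≤ L / 2 * ‖u‖ ^ 2 := hf.abs_sub_le (x i) (x j)
    rw [← sub_smul, show alphaConst d p.η * ((f (x j) - f (x i)) / ‖u‖ ^ 2) / stepDensity p.h (ξ j) -
      alphaConst d p.η * (⟪gradient f (x i), u⟫ / ‖u‖ ^ 2) / stepDensity p.h (ξ j) =
      1 / stepDensity p.h (ξ j) * (alphaConst d p.η * (r / ‖u‖ ^ 2)) by rw [hr]; ring,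
      norm_smul, norm_mul, norm_mul, Real.norm_of_nonneg hα, Real.norm_of_nonneg (by positivity),
      mul_assoc, mul_assoc, norm_div, norm_pow, norm_norm, Real.norm_eq_abs]
    have h1 : |r| / ‖u‖ ^ 2 * ‖u‖ ≤ L * p.η / 2 := by
      have h2 : |r| / ‖u‖ ^ 2 ≤ L / 2 := div_le_of_le_mul₀ (by positivity) (by positivity) h0
      calc |r| / ‖u‖ ^ 2 * ‖u‖ ≤ L / 2 * p.η := by gcongr
        _ = _ := by ring
    gcongr
  · rw [if_neg fun hc => hy hc.1, if_neg hy, sub_zero, norm_zero]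
    rw [Set.indicator_of_notMem (by rwa [mem_closedBall_iff_norm]), mul_zero]

/-- Once `ξ i` is fixed, the ball is fixed and the weighted law of particle `j` is Lebesgue measure,
so the value is `α_d V c`. -/
theorem lintegral_remainder {d N : ℕ} {h η c : ℝ} (hh : 0 < h) (hη : 0 < η) (hc : 0 ≤ c)
    (w : Fin N → RVec d) {i j : Fin N} (hij : j ≠ i) :
    ∫⁻ ξ : Fin N → RVec d, ENNReal.ofReal (1 / stepDensity h (ξ j) *
      (Metric.closedBall (w i + √(2 * h) • ξ i) η).indicator (fun _ => alphaConst d η * c)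
        (w j + √(2 * h) • ξ j)) ∂Measure.pi (fun _ => stdGaussian (RVec d)) =
      ENNReal.ofReal (d * c) := by
  have hm := (continuous_stepDensity (d := d) h).measurable
  have hα := alphaConst_nonneg d η
  rw [lintegral_pi_eq_lintegral_update _ i]
  swap
  · simp only [Set.indicator, mem_closedBall_iff_norm]
    refine Measurable.ennreal_ofReal (Measurable.mul (by fun_prop) (Measurable.ite
      (measurableSet_le (by fun_prop) measurable_const) measurable_const measurable_const))
  simp only [Function.update_of_ne hij, Function.update_self]
  have key : ∀ a : RVec d, ∫⁻ ξ : Fin N → RVec d, ENNReal.ofReal (1 / stepDensity h (ξ j) *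
      (Metric.closedBall (w i + √(2 * h) • a) η).indicator (fun _ => alphaConst d η * c)
        (w j + √(2 * h) • ξ j)) ∂Measure.pi (fun _ => stdGaussian (RVec d)) =
      ENNReal.ofReal (d * c) := by
    intro a
    set B := Metric.closedBall (w i + √(2 * h) • a) η
    let φ : RVec d → ℝ≥0∞ := B.indicator fun _ => ENNReal.ofReal (alphaConst d η * c)
    have hφ : Measurable φ := measurable_const.indicator measurableSet_closedBall
    have e : ∀ b : RVec d, ENNReal.ofReal (1 / stepDensity h b *
        B.indicator (fun _ => alphaConst d η * c) (w j + √(2 * h) • b)) =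
        ENNReal.ofReal (1 / stepDensity h b) * φ (w j + √(2 * h) • b) := by
      intro b
      have hp := stepDensity_pos hh b
      rw [ENNReal.ofReal_mul (by positivity)]
      congr 1
      simp only [φ, Set.indicator]
      split_ifs <;> simp
    simp_rw [e]
    rw [(measurePreserving_eval (fun _ : Fin N => stdGaussian (RVec d)) j).lintegral_comp
      (f := fun b => ENNReal.ofReal (1 / stepDensity h b) * φ (w j + √(2 * h) • b)) (by fun_prop),
      lintegral_importance hh (w j) φ hφ, lintegral_indicator_const measurableSet_closedBall,
      ← ENNReal.ofReal_toReal (measure_closedBall_lt_top (μ := volume)).ne,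
      ← ENNReal.ofReal_mul (by positivity), ← alphaConst_mul_volume hη (w i + √(2 * h) • a)]
    congr 1
    simp only [Measure.real]
    ring
  simp_rw [key]
  simp

theorem alphaConst_mul_volume_closedBall {d : ℕ} {η R : ℝ} (hη : 0 < η) (hR : 0 ≤ R) :
    alphaConst d η * (volume : Measure (RVec d)).real (Metric.closedBall 0 R) =
      d * (R ^ d / η ^ d) := by
  have h1 := (volume_real_closedBall_pos (d := d) one_pos 0).ne'
  rw [alphaConst, Measure.real, Measure.real, Measure.addHaar_closedBall' _ _ hR,
    Measure.addHaar_closedBall' _ _ hη.le, ENNReal.toReal_mul, ENNReal.toReal_mul,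
    ENNReal.toReal_ofReal (by positivity), ENNReal.toReal_ofReal (by positivity),
    finrank_euclideanSpace_fin]
  rw [Measure.real] at h1
  field_simp

/-! ### Force error for frozen `w` -/

/-- The deviation from the true gradient of the ensemble approximation built from the linearized
contributions of the particles in `S`, set to zero where the constraints are violated. -/
def fluctuation {d N : ℕ} (f : RVec d → ℝ) (p : CEnLMCParams) (S : Finset (Fin N))
    (w : Fin N → RVec d) (i : Fin N) (ξ : Fin N → RVec d) : RVec d :=
  if √(2 * p.h) * ‖ξ i‖ ≤ p.R₁ ∧ f (w i + √(2 * p.h) • ξ i) ≤ p.Mf then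
    (1 / (S.card : ℝ)) • ∑ j ∈ S, linForce p.h p.η (gradient f (w i + √(2 * p.h) • ξ i))
      (w i + √(2 * p.h) • ξ i) (w j + √(2 * p.h) • ξ j) (ξ j) -
      gradient f (w i + √(2 * p.h) • ξ i)
  else 0

theorem measurable_fluctuation {d N : ℕ} {f : RVec d → ℝ} {L : ℝ} (hf : IsLSmooth L f)
    (p : CEnLMCParams) (S : Finset (Fin N)) (w : Fin N → RVec d) (i : Fin N) :
    Measurable (fluctuation f p S w i) := by
  have hx : ∀ j, Measurable fun ξ : Fin N → RVec d => w j + √(2 * p.h) • ξ j := by fun_prop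
  have hg := hf.continuous_gradient.measurable.comp (hx i)
  have h1 : Measurable fun ξ : Fin N → RVec d =>
      ∑ j ∈ S, linForce p.h p.η (gradient f (w i + √(2 * p.h) • ξ i))
        (w i + √(2 * p.h) • ξ i) (w j + √(2 * p.h) • ξ j) (ξ j) :=
    Finset.measurable_sum _ fun j _ =>
      measurable_linForce _ _ hg (hx i) (hx j) (measurable_pi_apply j)
  have hfx : Measurable fun ξ : Fin N → RVec d => f (w i + √(2 * p.h) • ξ i) :=
    hf.1.continuous.measurable.comp (hx i)
  have hT : MeasurableSet {ξ : Fin N → RVec d | √(2 * p.h) * ‖ξ i‖ ≤ p.R₁ ∧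
      f (w i + √(2 * p.h) • ξ i) ≤ p.Mf} := by
    have hn : Measurable fun ξ : Fin N → RVec d => √(2 * p.h) * ‖ξ i‖ := by fun_prop
    rw [Set.ofPred_and]
    exact (measurableSet_le hn measurable_const).inter (measurableSet_le hfx measurable_const)
  have h2 : Measurable fun ξ : Fin N → RVec d => (1 / (S.card : ℝ)) •
      ∑ j ∈ S, linForce p.h p.η (gradient f (w i + √(2 * p.h) • ξ i))
        (w i + √(2 * p.h) • ξ i) (w j + √(2 * p.h) • ξ j) (ξ j) :=
    (measurable_const_smul (1 / (S.card : ℝ))).comp h1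
  unfold fluctuation
  exact Measurable.ite hT (h2.sub hg) measurable_const

/-- Given `ξ i = a`, the variance bound yields at most `κ / stepDensity h a`, and only for `√(2h)
|a| ≤ R₁`. Integrating over `a` is again an importance integral and produces `κ` times the volume of
the `R₁`-ball. -/
theorem lintegral_fluctuation_sq_le {d N : ℕ} {f : RVec d → ℝ} {L c : ℝ} (hf : IsLSmooth L f)
    (hL : 0 < L) (hc : ∀ y, c ≤ f y) (p : CEnLMCParams) (hh : 0 < p.h) (hη : 0 < p.η)
    (hηR : p.η ≤ p.R₂) (hR₁ : 0 ≤ p.R₁) (hNstar : 0 < p.Nstar) (hM : c < p.Mf)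
    (w : Fin N → RVec d) {i : Fin N} {S : Finset (Fin N)} (hi : i ∉ S)
    (hS : ∀ j ∈ S, ‖w j - w i‖ ≤ p.R₂) (hn : p.Nstar ≤ S.card) :
    ∫⁻ ξ : Fin N → RVec d,
      ‖fluctuation f p S w i ξ‖ₑ ^ 2 ∂Measure.pi (fun _ => stdGaussian (RVec d)) ≤
      ENNReal.ofReal (2 * (L * (p.R₁ ^ d * (p.Mf - c) * (d : ℝ) ^ 2 / (p.η ^ d * p.Nstar))) *
        Real.exp (p.R₂ * (p.R₂ + p.R₁) / p.h)) := by
  have hm := (continuous_stepDensity (d := d) p.h).measurable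
  have hα := alphaConst_nonneg d p.η
  have hn0 : (0 : ℝ) < S.card := hNstar.trans_le hn
  have hne : S.Nonempty := by
    rw [← Finset.card_pos]
    exact_mod_cast hn0
  have hMc : 0 < p.Mf - c := sub_pos.2 hM
  set E := Real.exp (p.R₂ * (p.R₂ + p.R₁) / p.h)
  rw [lintegral_pi_eq_lintegral_update _ i]
  swap
  · exact (measurable_fluctuation hf p S w i).enorm.pow_const 2
  set κ := alphaConst d p.η * d * (2 * L * (p.Mf - c)) * E / p.Nstar with hκ
  let φ : RVec d → ℝ≥0∞ := (Metric.closedBall 0 p.R₁).indicator fun _ => ENNReal.ofReal κ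
  have hφ : Measurable φ := measurable_const.indicator measurableSet_closedBall
  have hκ0 : 0 ≤ κ := by positivity
  -- The centre `0` appears because the constraint limits the displacement `√(2h) a`, not the
  -- position.
  calc _ ≤ ∫⁻ a : RVec d, ENNReal.ofReal (1 / stepDensity p.h a) * φ (0 + √(2 * p.h) • a)
        ∂stdGaussian (RVec d) := by
        refine lintegral_mono fun a => ?_
        simp only [fluctuation, Function.update_self]
        by_cases ha : √(2 * p.h) * ‖a‖ ≤ p.R₁ ∧ f (w i + √(2 * p.h) • a) ≤ p.Mf
        swap
        · simp only [if_neg ha]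
          simp
        have hp := stepDensity_pos hh a
        simp only [if_pos ha]
        rw [zero_add]
        simp only [φ]
        rw [Set.indicator_of_mem (by rw [mem_closedBall_zero_iff, norm_smul,
          Real.norm_of_nonneg (Real.sqrt_nonneg _)]; exact ha.1),
          ← ENNReal.ofReal_mul (by positivity)]
        set x := w i + √(2 * p.h) • a
        set g := gradient f x
        have hbd : ∀ j ∈ S, ∀ ξ : RVec d, ‖w j + √(2 * p.h) • ξ - x‖ ≤ p.η →
            1 / stepDensity p.h ξ ≤ 1 / stepDensity p.h a * E := fun j hj ξ hξ =>
          inv_stepDensity_le hh hηR (hη.le.trans hηR) ha.1 (hS j hj) hξ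
        have hvar := integral_norm_average_sub_sq_le (stdGaussian (RVec d)) S hne
          (fun j ξ => linForce p.h p.η g x (w j + √(2 * p.h) • ξ) ξ)
          (fun j => measurable_linForce _ _ measurable_const measurable_const (by fun_prop)
            measurable_id)
          (fun _ => 1 / stepDensity p.h a * E * (alphaConst d p.η * ‖g‖)) ?_ g
          (fun j _ k => integral_linForce_coord hh hη g x (w j) k)
          (fun j hj => integral_norm_linForce_sq_le hh hη g x (w j) (hbd j hj))
        swap
        · intro j hj ξ
          refine (norm_linForce_le hh _ _ _ _ _).trans ?_
          simp only [Set.indicator, mem_closedBall_iff_norm]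
          split_ifs with hy
          · exact mul_le_mul_of_nonneg_right (hbd j hj ξ hy) (by positivity)
          · simp only [mul_zero]; positivity
        have hg2 : ‖g‖ ^ 2 ≤ 2 * L * (p.Mf - c) :=
          (hf.norm_gradient_sq_le hL hc x).trans (by have := ha.2; gcongr)
        have e : ∀ ξ : Fin N → RVec d, ‖(1 / (S.card : ℝ)) • ∑ j ∈ S, linForce p.h p.η g x
            (w j + √(2 * p.h) • Function.update ξ i a j) (Function.update ξ i a j) - g‖ₑ ^ 2 =
            ENNReal.ofReal (‖(1 / (S.card : ℝ)) • ∑ j ∈ S, linForce p.h p.η g x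
              (w j + √(2 * p.h) • ξ j) (ξ j) - g‖ ^ 2) := by
          intro ξ
          rw [ENNReal.ofReal_pow (norm_nonneg _), ofReal_norm]
          rw [Finset.sum_congr rfl fun j hj => by
            rw [Function.update_of_ne (ne_of_mem_of_not_mem hj hi)]]
        simp_rw [e]
        rw [← ofReal_integral_eq_lintegral_ofReal hvar.1
          (Filter.Eventually.of_forall fun _ => sq_nonneg _)]
        refine ENNReal.ofReal_le_ofReal (hvar.2.trans ?_)
        calc _ ≤ alphaConst d p.η * d * (2 * L * (p.Mf - c)) * (1 / stepDensity p.h a * E) /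
              p.Nstar := by gcongr
          _ = _ := by rw [hκ]; ring
    _ = ENNReal.ofReal κ * volume (Metric.closedBall (0 : RVec d) p.R₁) := by
        rw [lintegral_importance hh 0 φ hφ, lintegral_indicator_const measurableSet_closedBall]
    _ = ENNReal.ofReal (κ * (volume : Measure (RVec d)).real (Metric.closedBall 0 p.R₁)) := by
        rw [ENNReal.ofReal_mul hκ0, Measure.real,
          ENNReal.ofReal_toReal (measure_closedBall_lt_top (μ := volume)).ne]
    _ = _ := by
        congr 1
        rw [show κ * (volume : Measure (RVec d)).real (Metric.closedBall 0 p.R₁) =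
          alphaConst d p.η * (volume : Measure (RVec d)).real (Metric.closedBall 0 p.R₁) *
          (d * (2 * L * (p.Mf - c)) * E / p.Nstar) by rw [hκ]; ring,
          alphaConst_mul_volume_closedBall hη hR₁]
        field_simp

/-- The bound on the expected difference between the force of the constrained ensemble algorithm
and the true gradient. -/
def forceError (d : ℕ) (p : CEnLMCParams) (L c : ℝ) : ℝ :=
  d * (L * p.η / 2) +
    √(2 * (L * (p.R₁ ^ d * (p.Mf - c) * (d : ℝ) ^ 2 / (p.η ^ d * p.Nstar))) *
      Real.exp (p.R₂ * (p.R₂ + p.R₁) / p.h))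

/-- The fluctuation is bounded in `L²`, hence in `L¹` by Cauchy–Schwarz; the remainders are bounded
directly in `L¹`, each having mean `d L η / 2`. -/
theorem lintegral_force_error_le {d N : ℕ} {f : RVec d → ℝ} {L c : ℝ} (hf : IsLSmooth L f)
    (hL : 0 < L) (hc : ∀ y, c ≤ f y) (p : CEnLMCParams) (hh : 0 < p.h) (hη : 0 < p.η)
    (hηR : p.η ≤ p.R₂) (hR₁ : 0 ≤ p.R₁) (hNstar : 0 < p.Nstar) (hM : c < p.Mf)
    (w : Fin N → RVec d) (i : Fin N) :
    ∫⁻ ξ : Fin N → RVec d, ‖cenlmcForce f p (fun j => w j + √(2 * p.h) • ξ j) w ξ i -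
      gradient f (w i + √(2 * p.h) • ξ i)‖ₑ ∂Measure.pi (fun _ => stdGaussian (RVec d)) ≤
      ENNReal.ofReal (forceError d p L c) := by
  classical
  set S : Finset (Fin N) := {j ∈ Finset.univ.erase i | ‖w j - w i‖ ≤ p.R₂} with hS
  have hcard : neighborCount p.R₂ w i = S.card := neighborCount_eq_card _ _ _
  by_cases hn : p.Nstar > (S.card : ℝ)
  -- With too few neighbours the true gradient is used for every `ξ`.
  · simp [cenlmcForce, hcard, hn]
  rw [not_lt] at hn
  have hn0 : (0 : ℝ) < S.card := hNstar.trans_le hn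
  have hi : i ∉ S := by simp [hS]
  have hSR : ∀ j ∈ S, ‖w j - w i‖ ≤ p.R₂ := fun j hj => (Finset.mem_filter.1 hj).2
  have hm := (continuous_stepDensity (d := d) p.h).measurable
  have hα := alphaConst_nonneg d p.η
  have hVm := measurable_fluctuation hf p S w i
  have hV2 := lintegral_enorm_le_of_lintegral_sq_le hVm.aestronglyMeasurable
    (lintegral_fluctuation_sq_le hf hL hc p hh hη hηR hR₁ hNstar hM w hi hSR hn)
  let R : Fin N → (Fin N → RVec d) → ℝ := fun j ξ => 1 / stepDensity p.h (ξ j) *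
      (Metric.closedBall (w i + √(2 * p.h) • ξ i) p.η).indicator
        (fun _ => alphaConst d p.η * (L * p.η / 2)) (w j + √(2 * p.h) • ξ j)
  have hR0 : ∀ j ξ, 0 ≤ R j ξ := fun j ξ => by
    have := stepDensity_pos hh (ξ j)
    exact mul_nonneg (by positivity) (Set.indicator_nonneg (fun _ _ => by positivity) _)
  have hpt : ∀ ξ : Fin N → RVec d, ‖cenlmcForce f p (fun j => w j + √(2 * p.h) • ξ j) w ξ i -
      gradient f (w i + √(2 * p.h) • ξ i)‖ₑ ≤
      ‖fluctuation f p S w i ξ‖ₑ + ENNReal.ofReal (1 / S.card) * ∑ j ∈ S, ENNReal.ofReal (R j ξ) := by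
    intro ξ
    by_cases hgood : √(2 * p.h) * ‖ξ i‖ ≤ p.R₁ ∧ f (w i + √(2 * p.h) • ξ i) ≤ p.Mf
    · have hcond : ¬ (√(2 * p.h) * ‖ξ i‖ > p.R₁ ∨ f (w i + √(2 * p.h) • ξ i) > p.Mf ∨
          p.Nstar > (neighborCount p.R₂ w i : ℝ)) := by
        rw [hcard]
        push Not
        exact ⟨hgood.1, hgood.2, hn⟩
      rw [cenlmcForce, if_neg hcond, hcard]
      rw [fluctuation, if_pos hgood]
      set x : Fin N → RVec d := fun j => w j + √(2 * p.h) • ξ j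
      have hsum : ∑ j ∈ Finset.univ.erase i, pairForce f p x w ξ i j =
          ∑ j ∈ S, pairForce f p x w ξ i j := by
        rw [hS, Finset.sum_filter]
        refine Finset.sum_congr rfl fun j _ => ?_
        by_cases hj : ‖w j - w i‖ ≤ p.R₂
        · rw [if_pos hj]
        · rw [if_neg hj, pairForce, if_neg fun hc => hj hc.2]
      rw [hsum, ← ENNReal.ofReal_sum_of_nonneg fun j _ => hR0 j ξ,
        ← ENNReal.ofReal_mul (by positivity), ← ofReal_norm, ← ofReal_norm,
        ← ENNReal.ofReal_add (norm_nonneg _) (mul_nonneg (by positivity)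
          (Finset.sum_nonneg fun j _ => hR0 j ξ))]
      refine ENNReal.ofReal_le_ofReal ?_
      have e : (1 / (S.card : ℝ)) • ∑ j ∈ S, pairForce f p x w ξ i j - gradient f (x i) =
          ((1 / (S.card : ℝ)) • ∑ j ∈ S, linForce p.h p.η (gradient f (x i)) (x i) (x j) (ξ j) -
          gradient f (x i)) + (1 / (S.card : ℝ)) • ∑ j ∈ S, (pairForce f p x w ξ i j -
            linForce p.h p.η (gradient f (x i)) (x i) (x j) (ξ j)) := by
        rw [Finset.sum_sub_distrib]
        module
      refine (congrArg norm e).le.trans ((norm_add_le _ _).trans (add_le_add le_rfl ?_))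
      rw [norm_smul, Real.norm_of_nonneg (by positivity)]
      refine mul_le_mul_of_nonneg_left ((norm_sum_le _ _).trans (Finset.sum_le_sum fun j hj => ?_))
        (by positivity)
      exact norm_pairForce_sub_linForce_le hf hL.le p hh x w ξ (hSR j hj)
    · have hcond : (√(2 * p.h) * ‖ξ i‖ > p.R₁ ∨ f (w i + √(2 * p.h) • ξ i) > p.Mf ∨
          p.Nstar > (neighborCount p.R₂ w i : ℝ)) := by
        rw [not_and_or, not_le, not_le] at hgood
        tauto
      rw [cenlmcForce, if_pos hcond]
      simp
  refine (lintegral_mono hpt).trans ?_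
  rw [lintegral_add_left hVm.enorm, forceError, add_comm,
    ENNReal.ofReal_add (by positivity) (Real.sqrt_nonneg _)]
  refine add_le_add ?_ hV2
  rw [lintegral_const_mul' _ _ ENNReal.ofReal_ne_top, lintegral_finsetSum']
  swap
  · intro j _
    refine Measurable.aemeasurable ?_
    simp only [R, Set.indicator, mem_closedBall_iff_norm]
    exact Measurable.ennreal_ofReal (Measurable.mul (by fun_prop) (Measurable.ite
      (measurableSet_le (by fun_prop) measurable_const) measurable_const measurable_const))
  rw [Finset.sum_congr rfl fun j hj => lintegral_remainder hh hη (by positivity) w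
    (ne_of_mem_of_not_mem hj hi), Finset.sum_const, nsmul_eq_mul, ← mul_assoc,
    ENNReal.ofReal_div_of_pos hn0, ENNReal.ofReal_one, ENNReal.ofReal_natCast, one_div,
    ENNReal.inv_mul_cancel (by exact_mod_cast hn0.ne') (by simp), one_mul]

/-! ### Measurability of the two dynamics -/

section Measurability

variable {α : Type*} [MeasurableSpace α] {d N : ℕ} {f : RVec d → ℝ} {L : ℝ}
  {x w ξ : α → Fin N → RVec d}

theorem measurable_neighborCount (R₂ : ℝ) (hw : ∀ j, Measurable fun a => w a j) (i : Fin N) :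
    Measurable fun a => (neighborCount R₂ (w a) i : ℝ) := by
  simp_rw [neighborCount_eq_card, Finset.card_filter]
  push_cast
  refine Finset.measurable_sum _ fun j _ => Measurable.ite ?_ measurable_const measurable_const
  have h1 : Measurable fun a => ‖w a j - w a i‖ := ((hw j).sub (hw i)).norm
  exact measurableSet_le h1 measurable_const

theorem measurable_pairForce (hf : IsLSmooth L f) (p : CEnLMCParams)
    (hx : ∀ j, Measurable fun a => x a j) (hw : ∀ j, Measurable fun a => w a j)
    (hξ : ∀ j, Measurable fun a => ξ a j) (i j : Fin N) :
    Measurable fun a => pairForce f p (x a) (w a) (ξ a) i j := by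
  have hm := (continuous_stepDensity (d := d) p.h).measurable.comp (hξ j)
  have hfx : ∀ k, Measurable fun a => f (x a k) := fun k => hf.1.continuous.measurable.comp (hx k)
  have hu : Measurable fun a => x a j - x a i := (hx j).sub (hx i)
  have hT : MeasurableSet {a | ‖x a j - x a i‖ ≤ p.η ∧ ‖w a j - w a i‖ ≤ p.R₂} := by
    rw [Set.ofPred_and]
    exact (measurableSet_le hu.norm measurable_const).inter
      (measurableSet_le ((hw j).sub (hw i)).norm measurable_const)
  have hc : Measurable fun a => alphaConst d p.η *
      ((f (x a j) - f (x a i)) / ‖x a j - x a i‖ ^ 2) / stepDensity p.h (ξ a j) :=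
    ((((hfx j).sub (hfx i)).div (hu.norm.pow_const 2)).const_mul _).div hm
  unfold pairForce
  exact Measurable.ite hT (hc.smul hu) measurable_const

theorem measurable_cenlmcForce (hf : IsLSmooth L f) (p : CEnLMCParams)
    (hx : ∀ j, Measurable fun a => x a j) (hw : ∀ j, Measurable fun a => w a j)
    (hξ : ∀ j, Measurable fun a => ξ a j) (i : Fin N) :
    Measurable fun a => cenlmcForce f p (x a) (w a) (ξ a) i := by
  have hN := measurable_neighborCount p.R₂ hw i
  have hT : MeasurableSet {a | Real.sqrt (2 * p.h) * ‖ξ a i‖ > p.R₁ ∨ f (x a i) > p.Mf ∨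
      p.Nstar > (neighborCount p.R₂ (w a) i : ℝ)} := by
    rw [Set.ofPred_or, Set.ofPred_or]
    exact (measurableSet_lt measurable_const ((hξ i).norm.const_mul _)).union
      ((measurableSet_lt measurable_const (hf.1.continuous.measurable.comp (hx i))).union
        (measurableSet_lt hN measurable_const))
  have hs : Measurable fun a => ∑ j ∈ Finset.univ.erase i, pairForce f p (x a) (w a) (ξ a) i j :=
    Finset.measurable_sum _ fun j _ => measurable_pairForce hf p hx hw hξ i j
  unfold cenlmcForce
  exact Measurable.ite hT (hf.continuous_gradient.measurable.comp (hx i))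
    ((measurable_const.div hN).smul hs)

theorem measurable_cenlmcState (hf : IsLSmooth L f) (p : CEnLMCParams)
    {x0 : α → Fin N → RVec d} {ξ : α → ℕ → Fin N → RVec d}
    (hx : ∀ j, Measurable fun a => x0 a j) (hξ : ∀ n j, Measurable fun a => ξ a n j) (m : ℕ) :
    (∀ i, Measurable fun a => (cenlmcState f p (x0 a) (ξ a) m).1 i) ∧
      ∀ i, Measurable fun a => (cenlmcState f p (x0 a) (ξ a) m).2 i := by
  induction m with
  | zero => exact ⟨hx, fun i => hf.continuous_gradient.measurable.comp (hx i)⟩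
  | succ m ih =>
    have hw : ∀ i, Measurable fun a => (cenlmcState f p (x0 a) (ξ a) m).1 i -
        p.h • (cenlmcState f p (x0 a) (ξ a) m).2 i := fun i =>
      (ih.1 i).sub ((measurable_const_smul p.h).comp (ih.2 i))
    have hx' : ∀ i, Measurable fun a => (cenlmcState f p (x0 a) (ξ a) m).1 i -
        p.h • (cenlmcState f p (x0 a) (ξ a) m).2 i + Real.sqrt (2 * p.h) • ξ a m i := fun i =>
      (hw i).add ((measurable_const_smul _).comp (hξ m i))
    exact ⟨hx', fun i => measurable_cenlmcForce hf p hx' hw (hξ m) i⟩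

theorem measurable_lmc (hf : IsLSmooth L f) (h : ℝ)
    {z0 : α → Fin N → RVec d} {ξ : α → ℕ → Fin N → RVec d}
    (hz : ∀ j, Measurable fun a => z0 a j) (hξ : ∀ n j, Measurable fun a => ξ a n j) (m : ℕ)
    (i : Fin N) : Measurable fun a => lmc f h (z0 a) (ξ a) m i := by
  induction m with
  | zero => exact hz i
  | succ m ih =>
    exact (ih.sub ((measurable_const_smul h).comp (hf.continuous_gradient.measurable.comp ih))).add
      ((measurable_const_smul _).comp (hξ m i))

end Measurability

/-! ### Conditioning on the past, and the error recursion -/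

theorem cenlmcState_congr {d N : ℕ} (f : RVec d → ℝ) (p : CEnLMCParams) (x0 : Fin N → RVec d)
    {ξ ξ' : ℕ → Fin N → RVec d} {m : ℕ} (h : ∀ k < m, ξ k = ξ' k) :
    cenlmcState f p x0 ξ m = cenlmcState f p x0 ξ' m := by
  induction m with
  | zero => rfl
  | succ m ih =>
    simp only [cenlmcState, ih fun k hk => h k (hk.trans m.lt_succ_self), h m m.lt_succ_self]

/-- The vector `w` is a function of the initial positions and the noise before step `m`, hence
independent of the noise of step `m`; Fubini reduces to the case of frozen `w`. -/
theorem lintegral_cenlmcState_force_error_le {d N : ℕ} {f : RVec d → ℝ} {L c : ℝ}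
    (hf : IsLSmooth L f) (hL : 0 < L) (hc : ∀ y, c ≤ f y) (p : CEnLMCParams) (hh : 0 < p.h)
    (hη : 0 < p.η) (hηR : p.η ≤ p.R₂) (hR₁ : 0 ≤ p.R₁) (hNstar : 0 < p.Nstar) (hM : c < p.Mf)
    {Ω : Type*} [MeasurableSpace Ω] (P : Measure Ω) [IsProbabilityMeasure P]
    {x0 : Fin N → Ω → RVec d} {ξ : ℕ → Fin N → Ω → RVec d}
    (hx0 : ∀ i, Measurable (x0 i)) (hξ : ∀ m i, Measurable (ξ m i))
    (hlaw : ∀ m i, P.map (ξ m i) = stdGaussian (RVec d))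
    (hind : iIndepFun (Sum.elim x0 (fun k : ℕ × Fin N => ξ k.1 k.2)) P) (m : ℕ) (i : Fin N) :
    ∫⁻ ω, ‖(cenlmcState f p (fun j => x0 j ω) (fun n j => ξ n j ω) m).2 i -
      gradient f ((cenlmcState f p (fun j => x0 j ω) (fun n j => ξ n j ω) m).1 i)‖ₑ ∂P ≤
      ENNReal.ofReal (forceError d p L c) := by
  cases m with
  | zero => simp [cenlmcState]
  | succ m =>
    have hall : ∀ k, Measurable (Sum.elim x0 (fun k : ℕ × Fin N => ξ k.1 k.2) k) := by
      rintro (j | k)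
      · exact hx0 j
      · exact hξ _ _
    -- `S` indexes the past (initial positions and noise before step `m`), `T` the noise of step
    -- `m`.
    let S : Finset (Fin N ⊕ ℕ × Fin N) := Finset.univ.disjSum (Finset.range m ×ˢ Finset.univ)
    let T : Finset (Fin N ⊕ ℕ × Fin N) := Finset.disjSum ∅ ({m} ×ˢ Finset.univ)
    have hST : Disjoint S T := by
      rw [Finset.disjoint_left]
      rintro (j | ⟨k, j⟩) h1 h2
      · simp [T] at h2
      · simp [S] at h1
        simp [T] at h2
        omega
    have hindST := hind.indepFun_finset S T hST hall
    have hinl : ∀ j, Sum.inl j ∈ S := fun j => by simp [S]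
    have hinr : ∀ k j, k < m → Sum.inr (k, j) ∈ S := fun k j hk => by simp [S, hk]
    have hinrT : ∀ j, Sum.inr (m, j) ∈ T := fun j => by simp [T]
    -- The state rebuilt from the past alone; the noise from step `m` on is set to `0`, which is
    -- harmless by `cenlmcState_congr`.
    let st : (S → RVec d) → (Fin N → RVec d) × (Fin N → RVec d) := fun v =>
      cenlmcState f p (fun j => v ⟨Sum.inl j, hinl j⟩)
        (fun k j => if hk : k < m then v ⟨Sum.inr (k, j), hinr k j hk⟩ else 0) m
    let Φ : (S → RVec d) → Fin N → RVec d := fun v j => (st v).1 j - p.h • (st v).2 j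
    let Θ : (T → RVec d) → Fin N → RVec d := fun v j => v ⟨Sum.inr (m, j), hinrT j⟩
    have hst := measurable_cenlmcState (α := S → RVec d) hf p
      (x0 := fun v j => v ⟨Sum.inl j, hinl j⟩)
      (ξ := fun v k j => if hk : k < m then v ⟨Sum.inr (k, j), hinr k j hk⟩ else 0)
      (fun j => measurable_pi_apply _) (fun k j => by
        by_cases hk : k < m
        · simp only [hk, dif_pos]; exact measurable_pi_apply _
        · simp only [hk, dif_neg, not_false_eq_true]; exact measurable_const) m
    have hΦ : Measurable Φ := measurable_pi_lambda _ fun j =>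
      (hst.1 j).sub ((measurable_const_smul p.h).comp (hst.2 j))
    have hΘ : Measurable Θ := measurable_pi_lambda _ fun j => measurable_pi_apply _
    have hWΞ := hindST.comp hΦ hΘ
    let W : Ω → Fin N → RVec d := fun ω j =>
      (cenlmcState f p (fun j => x0 j ω) (fun n j => ξ n j ω) m).1 j -
        p.h • (cenlmcState f p (fun j => x0 j ω) (fun n j => ξ n j ω) m).2 j
    let Ξ : Ω → Fin N → RVec d := fun ω j => ξ m j ω
    have hW : Φ ∘ (fun ω (k : S) => Sum.elim x0 (fun k : ℕ × Fin N => ξ k.1 k.2) k ω) = W := by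
      funext ω
      have : st (fun k : S => Sum.elim x0 (fun k : ℕ × Fin N => ξ k.1 k.2) k ω) =
          cenlmcState f p (fun j => x0 j ω) (fun n j => ξ n j ω) m := by
        refine cenlmcState_congr f p _ fun k hk => ?_
        funext j
        simp [hk]
      simp only [Function.comp_apply, Φ, W, this]
    have hΞ : Θ ∘ (fun ω (k : T) => Sum.elim x0 (fun k : ℕ × Fin N => ξ k.1 k.2) k ω) = Ξ := rfl
    rw [hW, hΞ] at hWΞ
    have hWm : Measurable W := hW ▸ hΦ.comp (measurable_pi_lambda _ fun k => hall k)
    have hΞm : Measurable Ξ := measurable_pi_lambda _ fun j => hξ m j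
    have hΞlaw : P.map Ξ = Measure.pi fun _ => stdGaussian (RVec d) := by
      have h1 := hind.precomp (g := fun j : Fin N => Sum.inr (m, j))
        (fun a b hab => by simpa using hab)
      have h2 := (iIndepFun_iff_map_fun_eq_pi_map fun j => (hξ m j).aemeasurable).1 h1
      simp only [hlaw] at h2
      exact h2
    have hjoint := (indepFun_iff_map_prod_eq_prod_map_map hWm.aemeasurable hΞm.aemeasurable).1 hWΞ
    let G : (Fin N → RVec d) × (Fin N → RVec d) → ℝ≥0∞ := fun q =>
      ‖cenlmcForce f p (fun j => q.1 j + √(2 * p.h) • q.2 j) q.1 q.2 i -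
        gradient f (q.1 i + √(2 * p.h) • q.2 i)‖ₑ
    have hG : Measurable G := by
      have hw : ∀ j, Measurable fun q : (Fin N → RVec d) × (Fin N → RVec d) => q.1 j :=
        fun j => (measurable_pi_apply j).comp measurable_fst
      have hξ' : ∀ j, Measurable fun q : (Fin N → RVec d) × (Fin N → RVec d) => q.2 j :=
        fun j => (measurable_pi_apply j).comp measurable_snd
      have hx : ∀ j, Measurable fun q : (Fin N → RVec d) × (Fin N → RVec d) =>
          q.1 j + √(2 * p.h) • q.2 j :=
        fun j => (hw j).add ((measurable_const_smul _).comp (hξ' j))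
      exact ((measurable_cenlmcForce hf p hx hw hξ' i).sub
        (hf.continuous_gradient.measurable.comp (hx i))).enorm
    have := Measure.isProbabilityMeasure_map (μ := P) hWm.aemeasurable
    calc _ = ∫⁻ ω, G (W ω, Ξ ω) ∂P := rfl
      _ = ∫⁻ v, ∫⁻ η, G (v, η) ∂Measure.pi (fun _ => stdGaussian (RVec d)) ∂P.map W := by
        rw [← lintegral_map (f := G) hG (hWm.prodMk hΞm), hjoint, hΞlaw,
          lintegral_prod _ hG.aemeasurable]
      _ ≤ ∫⁻ _, ENNReal.ofReal (forceError d p L c) ∂P.map W := lintegral_mono fun v =>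
        lintegral_force_error_le hf hL hc p hh hη hηR hR₁ hNstar hM v i
      _ = _ := by simp

/-- Discrete Grönwall argument for any Lipschitz constant `q` of the gradient step and any
supersolution `b` of `b ↦ q b + h e`; both parts of the theorem are instances. -/
theorem lintegral_cenlmc_sub_lmc_le {d N : ℕ} {f : RVec d → ℝ} {L e : ℝ}
    (hf : IsLSmooth L f) (p : CEnLMCParams) (hh : 0 < p.h)
    {Ω : Type*} [MeasurableSpace Ω] (P : Measure Ω)
    {x0 : Fin N → Ω → RVec d} {ξ : ℕ → Fin N → Ω → RVec d}
    (hx0 : ∀ i, Measurable (x0 i)) (hξ : ∀ m i, Measurable (ξ m i)) (i : Fin N) (he : 0 ≤ e)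
    (herr : ∀ m, ∫⁻ ω, ‖(cenlmcState f p (fun j => x0 j ω) (fun n j => ξ n j ω) m).2 i -
      gradient f ((cenlmcState f p (fun j => x0 j ω) (fun n j => ξ n j ω) m).1 i)‖ₑ ∂P ≤
      ENNReal.ofReal e) {q : ℝ} (hq0 : 0 ≤ q)
    (hq : ∀ x y, ‖(x - p.h • gradient f x) - (y - p.h • gradient f y)‖ ≤ q * ‖x - y‖)
    {b : ℕ → ℝ} (hb0 : ∀ m, 0 ≤ b m) (hb : ∀ m, q * b m + p.h * e ≤ b (m + 1)) (m : ℕ) :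
    ∫⁻ ω, ‖cenlmc f p (fun j => x0 j ω) (fun n j => ξ n j ω) m i -
      lmc f p.h (fun j => x0 j ω) (fun n j => ξ n j ω) m i‖ₑ ∂P ≤ ENNReal.ofReal (b m) := by
  induction m with
  | zero => simp [cenlmc, cenlmcState, lmc]
  | succ m ih =>
    have hst := measurable_cenlmcState hf p (x0 := fun ω j => x0 j ω) (ξ := fun ω n j => ξ n j ω)
      hx0 hξ m
    have hlm := measurable_lmc hf p.h (z0 := fun ω j => x0 j ω) (ξ := fun ω n j => ξ n j ω)
      hx0 hξ m i
    have hdiff : Measurable fun ω =>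
        ENNReal.ofReal q * ‖cenlmc f p (fun j => x0 j ω) (fun n j => ξ n j ω) m i -
          lmc f p.h (fun j => x0 j ω) (fun n j => ξ n j ω) m i‖ₑ :=
      ((hst.1 i).sub hlm).enorm.const_mul _
    have hpt : ∀ ω, ‖cenlmc f p (fun j => x0 j ω) (fun n j => ξ n j ω) (m + 1) i -
        lmc f p.h (fun j => x0 j ω) (fun n j => ξ n j ω) (m + 1) i‖ₑ ≤
        ENNReal.ofReal q * ‖cenlmc f p (fun j => x0 j ω) (fun n j => ξ n j ω) m i -
          lmc f p.h (fun j => x0 j ω) (fun n j => ξ n j ω) m i‖ₑ + ENNReal.ofReal p.h *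
        ‖(cenlmcState f p (fun j => x0 j ω) (fun n j => ξ n j ω) m).2 i -
          gradient f ((cenlmcState f p (fun j => x0 j ω) (fun n j => ξ n j ω) m).1 i)‖ₑ := by
      intro ω
      simp only [← ofReal_norm]
      rw [← ENNReal.ofReal_mul hq0, ← ENNReal.ofReal_mul hh.le, ← ENNReal.ofReal_add
        (by positivity) (by positivity)]
      refine ENNReal.ofReal_le_ofReal ?_
      simp only [cenlmc, cenlmcState, lmc]
      set x := (cenlmcState f p (fun j => x0 j ω) (fun n j => ξ n j ω) m).1 i
      set F := (cenlmcState f p (fun j => x0 j ω) (fun n j => ξ n j ω) m).2 i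
      set z := lmc f p.h (fun j => x0 j ω) (fun n j => ξ n j ω) m i
      have e1 : x - p.h • F + √(2 * p.h) • ξ m i ω -
          (z - p.h • gradient f z + √(2 * p.h) • ξ m i ω) =
          ((x - p.h • gradient f x) - (z - p.h • gradient f z)) - p.h • (F - gradient f x) := by
        module
      rw [e1]
      refine (norm_sub_le _ _).trans (add_le_add (hq x z) ?_)
      rw [norm_smul, Real.norm_of_nonneg hh.le]
    refine (lintegral_mono hpt).trans ?_
    rw [lintegral_add_left hdiff,
      lintegral_const_mul' _ _ ENNReal.ofReal_ne_top,
      lintegral_const_mul' _ _ ENNReal.ofReal_ne_top]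
    refine (add_le_add (mul_le_mul_right ih _) (mul_le_mul_right (herr m) _)).trans ?_
    rw [← ENNReal.ofReal_mul hq0, ← ENNReal.ofReal_mul hh.le, ← ENNReal.ofReal_add
      (mul_nonneg hq0 (hb0 m)) (by positivity)]
    exact ENNReal.ofReal_le_ofReal (hb m)

theorem forceError_nonneg {d : ℕ} {p : CEnLMCParams} {L : ℝ} (hL : 0 < L) (hη : 0 < p.η) (c : ℝ) :
    0 ≤ forceError d p L c := by
  unfold forceError; positivity

/-- The scale `s` is what the error is later divided by: `s = L` in general and `s = μ` under strong
convexity. The square root halves the exponent. -/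
theorem forceError_le {d : ℕ} {p : CEnLMCParams} {L c s Y : ℝ} (hs : 0 ≤ s) (hY0 : 0 ≤ Y)
    (hY : s ^ 2 * Y = L * (p.R₁ ^ d * (p.Mf - c) * (d : ℝ) ^ 2 / (p.η ^ d * p.Nstar))) :
    forceError d p L c ≤ d * (L * p.η / 2) +
      2 * (s * (√Y * Real.exp (p.R₂ * (p.R₂ + p.R₁) / (2 * p.h)))) := by
  have hE : Real.exp (p.R₂ * (p.R₂ + p.R₁) / p.h) =
      Real.exp (p.R₂ * (p.R₂ + p.R₁) / (2 * p.h)) ^ 2 := by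
    rw [← Real.exp_nat_mul]
    congr 1
    push_cast
    rw [mul_comm 2 p.h, ← div_div]
    ring
  rw [forceError, hE, ← hY]
  refine add_le_add le_rfl (Real.sqrt_le_iff.2 ⟨by positivity, ?_⟩)
  rw [mul_pow, mul_pow, mul_pow, Real.sq_sqrt hY0]
  nlinarith [mul_nonneg (mul_nonneg (sq_nonneg s) hY0)
    (sq_nonneg (Real.exp (p.R₂ * (p.R₂ + p.R₁) / (2 * p.h))))]

end

theorem mainTheorem2 :
    ∃ C : ℝ, 0 < C ∧
      ∀ (d N : ℕ) (f : RVec d → ℝ) (L fstar : ℝ) (p : CEnLMCParams)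
        (Ω : Type*) [MeasurableSpace Ω] (P : Measure Ω) [IsProbabilityMeasure P]
        (ν : Measure (RVec d)) (x0 : Fin N → Ω → RVec d) (ξ : ℕ → Fin N → Ω → RVec d),
        0 < d → 0 < L → IsLSmooth L f → IsLeast (Set.range f) fstar →
        0 < p.h → p.h ≤ min (1 / L) (1 / (d : ℝ)) →
        0 < p.η → max p.η 1 ≤ p.R₂ → 0 ≤ p.R₁ → 0 < p.Nstar → fstar < p.Mf →
        (∀ i, Measurable (x0 i)) → (∀ m i, Measurable (ξ m i)) →
        (∀ i, P.map (x0 i) = ν) → (∀ m i, P.map (ξ m i) = stdGaussian (RVec d)) →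
        iIndepFun (Sum.elim x0 (fun k : ℕ × Fin N => ξ k.1 k.2)) P →
        (∀ (m : ℕ) (i : Fin N),
          Integrable (fun ω => cenlmc f p (fun j => x0 j ω) (fun n j => ξ n j ω) m i -
            lmc f p.h (fun j => x0 j ω) (fun n j => ξ n j ω) m i) P ∧
          ∫ ω, ‖cenlmc f p (fun j => x0 j ω) (fun n j => ξ n j ω) m i -
            lmc f p.h (fun j => x0 j ω) (fun n j => ξ n j ω) m i‖ ∂P ≤
            C * (Real.exp (L * m * p.h) *
              (Real.sqrt (p.R₁ ^ d * (p.Mf - fstar) * (d : ℝ) ^ 2 / (L * p.η ^ d * p.Nstar)) *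
                Real.exp (p.R₂ * (p.R₂ + p.R₁) / (2 * p.h)) + p.η * d))) ∧
        (∀ μ : ℝ, 0 < μ → StrongConvexOn Set.univ μ f → ∀ (m : ℕ) (i : Fin N),
          ∫ ω, ‖cenlmc f p (fun j => x0 j ω) (fun n j => ξ n j ω) m i -
            lmc f p.h (fun j => x0 j ω) (fun n j => ξ n j ω) m i‖ ∂P ≤
            C * (Real.sqrt (p.R₁ ^ d * (L / μ) * (p.Mf - fstar) * (d : ℝ) ^ 2 /
                (μ * p.η ^ d * p.Nstar)) *
                Real.exp (p.R₂ * (p.R₂ + p.R₁) / (2 * p.h)) + (L / μ) * p.η * d)) := by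
  -- The strongly convex case needs `4`: a factor `2` from `forceError_le` and a factor `2` from the
  -- bound `2e/μ`.
  refine ⟨4, by norm_num, ?_⟩
  intro d N f L fstar p Ω _ P _ ν x0 ξ hd hL hf hmin hh hhle hη hR₂ hR₁ hNstar hM hx0 hξ _ hlaw hind
  have hc : ∀ y, fstar ≤ f y := fun y => hmin.2 ⟨y, rfl⟩
  have hηR : p.η ≤ p.R₂ := (le_max_left _ _).trans hR₂
  have hhL : p.h ≤ 1 / L := hhle.trans (min_le_left _ _)
  have hMc : 0 < p.Mf - fstar := sub_pos.2 hM
  set e := forceError d p L fstar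
  have he : 0 ≤ e := forceError_nonneg hL hη fstar
  have herr := lintegral_cenlmcState_force_error_le hf hL hc p hh hη hηR hR₁ hNstar hM P hx0 hξ
    hlaw hind
  have hmeas : ∀ m i, AEStronglyMeasurable (fun ω =>
      cenlmc f p (fun j => x0 j ω) (fun n j => ξ n j ω) m i -
        lmc f p.h (fun j => x0 j ω) (fun n j => ξ n j ω) m i) P := fun m i =>
    (((measurable_cenlmcState hf p (x0 := fun ω j => x0 j ω) (ξ := fun ω n j => ξ n j ω)
      hx0 hξ m).1 i).sub (measurable_lmc hf p.h (z0 := fun ω j => x0 j ω)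
        (ξ := fun ω n j => ξ n j ω) hx0 hξ m i)).aestronglyMeasurable
  set E := Real.exp (p.R₂ * (p.R₂ + p.R₁) / (2 * p.h)) with hE
  have hE0 : 0 < E := Real.exp_pos _
  have toReal : ∀ {b : ℝ} {m : ℕ} {i : Fin N}, 0 ≤ b →
      ∫⁻ ω, ‖cenlmc f p (fun j => x0 j ω) (fun n j => ξ n j ω) m i -
        lmc f p.h (fun j => x0 j ω) (fun n j => ξ n j ω) m i‖ₑ ∂P ≤ ENNReal.ofReal b →
      ∫ ω, ‖cenlmc f p (fun j => x0 j ω) (fun n j => ξ n j ω) m i -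
        lmc f p.h (fun j => x0 j ω) (fun n j => ξ n j ω) m i‖ ∂P ≤ b := by
    intro b m i hb h
    rw [integral_norm_eq_lintegral_enorm (hmeas m i)]
    exact ENNReal.toReal_le_of_le_ofReal hb h
  constructor
  · intro m i
    -- Supersolution for `q = 1 + Lh`, by `1 + Lh ≤ exp(Lh)`.
    have hb0 : ∀ m : ℕ, 0 ≤ e / L * (Real.exp (L * m * p.h) - 1) := fun m =>
      mul_nonneg (by positivity) (sub_nonneg.2 (Real.one_le_exp (by positivity)))
    have hD := lintegral_cenlmc_sub_lmc_le hf p hh P hx0 hξ i he (fun m => herr m i)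
      (q := 1 + L * p.h) (by positivity) (hf.norm_gradientStep_sub_le hh.le) hb0 (fun m => by
        have h1 := Real.add_one_le_exp (L * p.h)
        have h2 : Real.exp (L * (m + 1 : ℕ) * p.h) = Real.exp (L * p.h) * Real.exp (L * m * p.h) := by
          rw [← Real.exp_add]; congr 1; push_cast; ring
        rw [h2]
        have h3 : p.h * e = e / L * (L * p.h) := by field_simp
        rw [h3]
        have h4 := mul_le_mul_of_nonneg_right h1 (Real.exp_pos (L * m * p.h)).le
        calc _ = e / L * ((L * p.h + 1) * Real.exp (L * m * p.h) - 1) := by ring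
          _ ≤ _ := by gcongr) m
    refine ⟨⟨hmeas m i, hD.trans_lt ENNReal.ofReal_lt_top⟩, (toReal (hb0 m) hD).trans ?_⟩
    have hle : e ≤ _ := forceError_le (p := p) hL.le
      (Y := p.R₁ ^ d * (p.Mf - fstar) * (d : ℝ) ^ 2 / (L * p.η ^ d * p.Nstar)) (by positivity)
      (by field_simp)
    rw [← hE] at hle
    set Q := √(p.R₁ ^ d * (p.Mf - fstar) * (d : ℝ) ^ 2 / (L * p.η ^ d * p.Nstar)) * E
    have hQ : 0 ≤ Q := by positivity
    have hle' : e / L ≤ 4 * (Q + p.η * d) := by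
      rw [div_le_iff₀ hL]
      have : 0 ≤ L * Q := by positivity
      have : 0 ≤ L * (p.η * d) := by positivity
      linarith
    calc e / L * (Real.exp (L * m * p.h) - 1) ≤ e / L * Real.exp (L * m * p.h) := by
          gcongr; linarith
      _ ≤ 4 * (Q + p.η * d) * Real.exp (L * m * p.h) := by gcongr
      _ = _ := by ring
  · intro μ hμ hconv m i
    have hμL := hf.strongConvexity_le hd hconv
    have hhμ : p.h * μ ≤ 1 := by
      rw [le_div_iff₀ hL] at hhL
      exact (mul_le_mul_of_nonneg_left hμL hh.le).trans hhL
    -- `2e/μ` is the fixed point of `b ↦ (1 - hμ/2) b + h e`, so a constant sequence suffices.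
    have hb0 : 0 ≤ 2 * e / μ := by positivity
    have hD := lintegral_cenlmc_sub_lmc_le hf p hh P hx0 hξ i he (fun m => herr m i)
      (q := 1 - p.h * μ / 2) (by linarith)
      (hf.norm_gradientStep_sub_le_of_strongConvexOn hL hd hh.le hhL hμ hconv)
      (b := fun _ => 2 * e / μ) (fun _ => hb0) (fun _ => le_of_eq (by field_simp; ring)) m
    refine (toReal hb0 hD).trans ?_
    have hle : e ≤ _ := forceError_le (p := p) hμ.le
      (Y := p.R₁ ^ d * (L / μ) * (p.Mf - fstar) * (d : ℝ) ^ 2 / (μ * p.η ^ d * p.Nstar))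
      (by positivity) (by field_simp)
    rw [← hE] at hle
    set Q := √(p.R₁ ^ d * (L / μ) * (p.Mf - fstar) * (d : ℝ) ^ 2 / (μ * p.η ^ d * p.Nstar)) * E
    have h1 : μ * (4 * (Q + L / μ * p.η * d)) = 4 * (μ * Q) + 4 * (L * p.η * d) := by
      field_simp
    rw [div_le_iff₀ hμ, mul_comm _ μ, h1]
    have : 0 ≤ L * p.η * d := by positivity
    linarith
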